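/- Let $d\ge 1$ and let $\Omega\subset\mathbb R^d$ be a bounded open set with smooth boundary. Let $H^1(\Omega)$ carry the norm $\|y\|_{H^1(\Omega)}=(\|y\|_{L^2(\Omega)}^2+\|\nabla y\|_{L^2(\Omega)}^2)^{1/2}$, let $H^1_0(\Omega)$ be the closure of $C_c^\infty(\Omega)$ in $H^1(\Omega)$ with the norm $\|\varphi\|_{H^1_0(\Omega)}:=\|\nabla\varphi\|_{L^2(\Omega)}$, and let $H^{-1}(\Omega)=(H^1_0(\Omega))'$ carry the corresponding dual norm. Let $H^{1/2}(\partial\Omega)\subset L^2(\partial\Omega)$ be the space of traces $y_{|\partial\Omega}$ of functions $y\in H^1(\Omega)$, with the norm $\|g\|_{H^{1/2}(\partial\Omega)}=\inf\{\|y\|_{H^1(\Omega)} : y\in H^1(\Omega),\ y_{|\partial\Omega}=g\}$. Let $M>m>0$, let $L^\infty_F(\Omega)$ be any linear subspace (for instance a finite-dimensional one) of $L^\infty(\Omega)$, and put $$\mathcal U_{m,M}=\{u\in L^\infty_F(\Omega) : m\le u(x)\le M \text{ for a.e. } x\in\Omega\}.$$ Let $f\in H^{-1}(\Omega)$ and $g\in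 H^{1/2}(\partial\Omega)$. Then for every $u\in\mathcal U_{m,M}$ there is exactly one $y=\mathbb S(u)\in H^1(\Omega)$ with $-\operatorname{div}(u\nabla y)=f$ in $H^{-1}(\Omega)$, that is, $\int_\Omega u\nabla y\cdot\nabla\varphi\,dx=\langle f,\varphi\rangle$ for all $\varphi\in H^1_0(\Omega)$, and $y_{|\partial\Omega}=g$. For all $u_1,u_2\in\mathcal U_{m,M}$ the solutions $y_1=\mathbb S(u_1)$ and $y_2=\mathbb S(u_2)$ satisfy $y_1-y_2\in H^1_0(\Omega)$ and $$\|y_1-y_2\|_{H^1_0(\Omega)}\le\frac1{m^2}\,\|u_1-u_2\|_{L^\infty(\Omega)}\left(\|f\|_{H^{-1}(\Omega)}+M\|g\|_{H^{1/2}(\partial\Omega)}\right).$$ In particular, the control-to-state map $\mathbb S:\mathcal U_{m,M}\to H^1(\Omega)$, with the $L^\infty(\Omega)$ distance on $\mathcal U_{m,M}$, is Lipschitz continuous. -/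

import Mathlib

open MeasureTheory Filter Topology Set
open scoped ENNReal NNReal ContDiff

namespace Conductivity

noncomputable section

/-- The Euclidean space `ℝ^d`. -/
abbrev E (d : ℕ) : Type := EuclideanSpace ℝ (Fin d)

/-- A bounded open set with smooth boundary: near each boundary point, `Ω` is the
sublevel set `{ρ < 0}` of a smooth function whose differential does not vanish at that point. -/
structure IsSmoothBoundedOpen {d : ℕ} (Ω : Set (E d)) : Prop where
  isOpen : IsOpen Ω
  isBounded : Bornology.IsBounded Ω
  smooth_boundary : ∀ x ∈ frontier Ω, ∃ (V : Set (E d)) (ρ : E d → ℝ),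
    IsOpen V ∧ x ∈ V ∧ ContDiffOn ℝ ∞ ρ V ∧ fderiv ℝ ρ x ≠ 0 ∧
      Ω ∩ V = {z ∈ V | ρ z < 0}

/-- `L²(Ω)`. -/
abbrev L2 {d : ℕ} (Ω : Set (E d)) := Lp ℝ 2 (volume.restrict Ω)

/-- `L²(Ω; ℝ^d)`. -/
abbrev L2Vec {d : ℕ} (Ω : Set (E d)) := Lp (E d) 2 (volume.restrict Ω)

/-- `L^∞(Ω)`. -/
abbrev LInf {d : ℕ} (Ω : Set (E d)) := Lp ℝ ∞ (volume.restrict Ω)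

/-- `φ ∈ C_c^∞(Ω)`. -/
structure IsTest {d : ℕ} (Ω : Set (E d)) (φ : E d → ℝ) : Prop where
  contDiff : ContDiff ℝ ∞ φ
  hasCompactSupport : HasCompactSupport φ
  tsupport_subset : tsupport φ ⊆ Ω

/-- `G` is the weak gradient of `y` on `Ω`. -/
def IsWeakGradient {d : ℕ} {Ω : Set (E d)} (y : L2 Ω) (G : L2Vec Ω) : Prop :=
  ∀ φ : E d → ℝ, IsTest Ω φ → ∀ v : E d,
    ∫ x in Ω, y x * fderiv ℝ φ x v = - ∫ x in Ω, inner ℝ (G x) v * φ x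

lemma integrable_mul_fderiv {d : ℕ} {Ω : Set (E d)} (y : L2 Ω) {φ : E d → ℝ}
    (h : IsTest Ω φ) (v : E d) :
    Integrable (fun x => y x * fderiv ℝ φ x v) (volume.restrict Ω) := by
  have hc : Continuous fun x => fderiv ℝ φ x v :=
    (h.contDiff.continuous_fderiv (by simp)).clm_apply continuous_const
  have hs : HasCompactSupport fun x => fderiv ℝ φ x v := h.hasCompactSupport.fderiv_apply ℝ v
  exact (Lp.memLp y).integrable_mul (hc.memLp_of_hasCompactSupport (p := 2) hs)

lemma integrable_inner_mul {d : ℕ} {Ω : Set (E d)} (G : L2Vec Ω) {φ : E d → ℝ}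
    (h : IsTest Ω φ) (v : E d) :
    Integrable (fun x => inner ℝ (G x) v * φ x) (volume.restrict Ω) :=
  ((Lp.memLp G).inner_const v).integrable_mul
    (h.contDiff.continuous.memLp_of_hasCompactSupport (p := 2) h.hasCompactSupport)

/-- The Sobolev space `H¹(Ω)`, each element being stored together with its (unique) weak
gradient. The ambient space carries the norm `(‖y‖²_{L²} + ‖∇y‖²_{L²})^{1/2}`. -/
def H1 {d : ℕ} (Ω : Set (E d)) : Submodule ℝ (WithLp 2 (L2 Ω × L2Vec Ω)) where
  carrier := {w | IsWeakGradient w.fst w.snd}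
  zero_mem' := by
    intro φ _ v
    have h1 : ∀ᵐ x ∂(volume.restrict Ω), ((0 : L2 Ω) x) * fderiv ℝ φ x v = 0 := by
      filter_upwards [Lp.coeFn_zero ℝ 2 (volume.restrict Ω)] with x hx
      rw [hx, Pi.zero_apply, zero_mul]
    have h2 : ∀ᵐ x ∂(volume.restrict Ω), inner ℝ ((0 : L2Vec Ω) x) v * φ x = 0 := by
      filter_upwards [Lp.coeFn_zero (E d) 2 (volume.restrict Ω)] with x hx
      rw [hx, Pi.zero_apply, inner_zero_left, zero_mul]
    have e1 := integral_congr_ae h1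
    have e2 := integral_congr_ae h2
    simp only [integral_zero] at e1 e2
    simp only [WithLp.zero_fst, WithLp.zero_snd]
    rw [e1, e2, neg_zero]
  add_mem' := by
    intro a b ha hb φ hφ v
    have h1 : ∀ᵐ x ∂(volume.restrict Ω), ((a.fst + b.fst : L2 Ω) x) * fderiv ℝ φ x v
        = a.fst x * fderiv ℝ φ x v + b.fst x * fderiv ℝ φ x v := by
      filter_upwards [Lp.coeFn_add a.fst b.fst] with x hx
      rw [hx, Pi.add_apply, add_mul]
    have h2 : ∀ᵐ x ∂(volume.restrict Ω), inner ℝ ((a.snd + b.snd : L2Vec Ω) x) v * φ x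
        = inner ℝ (a.snd x) v * φ x + inner ℝ (b.snd x) v * φ x := by
      filter_upwards [Lp.coeFn_add a.snd b.snd] with x hx
      rw [hx, Pi.add_apply, inner_add_left, add_mul]
    have e1 := integral_congr_ae h1
    have e2 := integral_congr_ae h2
    simp only [WithLp.add_fst, WithLp.add_snd]
    rw [e1, e2, integral_add (integrable_mul_fderiv _ hφ v) (integrable_mul_fderiv _ hφ v),
      integral_add (integrable_inner_mul _ hφ v) (integrable_inner_mul _ hφ v),
      ha φ hφ v, hb φ hφ v]
    ring
  smul_mem' := by
    intro c a ha φ hφ v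
    have h1 : ∀ᵐ x ∂(volume.restrict Ω), ((c • a.fst : L2 Ω) x) * fderiv ℝ φ x v
        = c * (a.fst x * fderiv ℝ φ x v) := by
      filter_upwards [Lp.coeFn_smul c a.fst] with x hx
      rw [hx, Pi.smul_apply, smul_eq_mul, mul_assoc]
    have h2 : ∀ᵐ x ∂(volume.restrict Ω), inner ℝ ((c • a.snd : L2Vec Ω) x) v * φ x
        = c * (inner ℝ (a.snd x) v * φ x) := by
      filter_upwards [Lp.coeFn_smul c a.snd] with x hx
      rw [hx, Pi.smul_apply, real_inner_smul_left, mul_assoc]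
    have e1 := integral_congr_ae h1
    have e2 := integral_congr_ae h2
    simp only [WithLp.smul_fst, WithLp.smul_snd]
    rw [e1, e2, integral_const_mul, integral_const_mul, ha φ hφ v]
    ring

/-- The function underlying an element of `H¹(Ω)`. -/
def fn {d : ℕ} {Ω : Set (E d)} (y : H1 Ω) : L2 Ω := (y : WithLp 2 (L2 Ω × L2Vec Ω)).fst

/-- The weak gradient of an element of `H¹(Ω)`. -/
def grad {d : ℕ} {Ω : Set (E d)} (y : H1 Ω) : L2Vec Ω := (y : WithLp 2 (L2 Ω × L2Vec Ω)).snd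

/-- `C_c^∞(Ω)` as a subspace of `H¹(Ω)`. -/
def testH1 {d : ℕ} (Ω : Set (E d)) : Submodule ℝ (H1 Ω) where
  carrier := {w | ∃ φ : E d → ℝ, IsTest Ω φ ∧ fn w =ᵐ[volume.restrict Ω] φ}
  zero_mem' := by
    refine ⟨0, ⟨contDiff_const, HasCompactSupport.zero, ?_⟩, Lp.coeFn_zero _ _ _⟩
    rw [tsupport_eq_empty_iff.2 rfl]
    exact empty_subset _
  add_mem' := by
    rintro a b ⟨φ, hφ, ha⟩ ⟨ψ, hψ, hb⟩
    refine ⟨φ + ψ, ⟨hφ.contDiff.add hψ.contDiff, hφ.hasCompactSupport.add hψ.hasCompactSupport,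
      (tsupport_add φ ψ).trans (union_subset hφ.tsupport_subset hψ.tsupport_subset)⟩, ?_⟩
    exact (Lp.coeFn_add (fn a) (fn b)).trans (ha.add hb)
  smul_mem' := by
    rintro c a ⟨φ, hφ, ha⟩
    refine ⟨c • φ, ⟨contDiff_const.smul hφ.contDiff, hφ.hasCompactSupport.smul_left (f := fun _ => c),
      (tsupport_smul_subset_right (fun _ => c) φ).trans hφ.tsupport_subset⟩, ?_⟩
    exact (Lp.coeFn_smul c (fn a)).trans (ha.const_smul c)

/-- `H¹₀(Ω)`: the closure of `C_c^∞(Ω)` in `H¹(Ω)`. -/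
def H10 {d : ℕ} (Ω : Set (E d)) : Submodule ℝ (H1 Ω) := (testH1 Ω).topologicalClosure

/-- `‖w‖_{H¹₀(Ω)} = ‖∇w‖_{L²(Ω)}`. -/
def h10Norm {d : ℕ} {Ω : Set (E d)} (w : H1 Ω) : ℝ := ‖grad w‖

/-- `H⁻¹(Ω)`, the topological dual of `H¹₀(Ω)`. -/
abbrev HNeg1 {d : ℕ} (Ω : Set (E d)) := StrongDual ℝ (H10 Ω)

/-- The norm of `H⁻¹(Ω)` dual to the norm `‖∇·‖_{L²(Ω)}` of `H¹₀(Ω)`: the least `C ≥ 0` with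
`|⟨f, φ⟩| ≤ C ‖∇φ‖_{L²(Ω)}` for all `φ ∈ H¹₀(Ω)`. -/
def hNeg1Norm {d : ℕ} {Ω : Set (E d)} (f : HNeg1 Ω) : ℝ :=
  sInf {C : ℝ | 0 ≤ C ∧ ∀ φ : H10 Ω, |f φ| ≤ C * h10Norm (φ : H1 Ω)}

/-- The surface measure of `∂Ω`: the `(d-1)`-dimensional Hausdorff measure restricted to `∂Ω`
(Mathlib's normalization of Hausdorff measure only changes it by a constant factor). -/
def surface {d : ℕ} (Ω : Set (E d)) : Measure (E d) :=
  (Measure.hausdorffMeasure ((d : ℝ) - 1)).restrict (frontier Ω)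

/-- `L²(∂Ω)`. -/
abbrev L2Bdry {d : ℕ} (Ω : Set (E d)) := Lp ℝ 2 (surface Ω)

/-- `h ∈ L²(∂Ω)` is the trace `y_{|∂Ω}` of `y ∈ H¹(Ω)`: there are functions `φ n`, smooth up to the
boundary, converging to `y` in `H¹(Ω)` whose restrictions to `∂Ω` converge to `h` in `L²(∂Ω)`.
This is the graph of the continuous extension to `H¹(Ω)` of the restriction `φ ↦ φ_{|∂Ω}`. -/
def HasTrace {d : ℕ} {Ω : Set (E d)} (y : H1 Ω) (h : L2Bdry Ω) : Prop :=
  ∃ (φ : ℕ → E d → ℝ) (w : ℕ → H1 Ω),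
    (∀ n, ContDiff ℝ ∞ (φ n) ∧ HasCompactSupport (φ n)) ∧
    (∀ n, fn (w n) =ᵐ[volume.restrict Ω] φ n) ∧
    Tendsto w atTop (𝓝 y) ∧
    Tendsto (fun n => eLpNorm (fun x => φ n x - h x) 2 (surface Ω)) atTop (𝓝 0)

/-- `g ∈ H^{1/2}(∂Ω)`: `g` is the trace of some element of `H¹(Ω)`. -/
def MemH12 {d : ℕ} {Ω : Set (E d)} (g : L2Bdry Ω) : Prop := ∃ y : H1 Ω, HasTrace y g

/-- The norm of `H^{1/2}(∂Ω)`: the infimum of `‖y‖_{H¹(Ω)}` over all `y ∈ H¹(Ω)` with trace `g`. -/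
def h12Norm {d : ℕ} {Ω : Set (E d)} (g : L2Bdry Ω) : ℝ :=
  sInf {r : ℝ | ∃ y : H1 Ω, HasTrace y g ∧ r = ‖y‖}

/-- The admissible conductivities: the `u` in the subspace `F` of `L^∞(Ω)` with `m ≤ u ≤ M` a.e. -/
def U {d : ℕ} {Ω : Set (E d)} (F : Submodule ℝ (LInf Ω)) (m M : ℝ) : Set (LInf Ω) :=
  {u | u ∈ F ∧ ∀ᵐ x ∂(volume.restrict Ω), m ≤ u x ∧ u x ≤ M}

/-- `y ∈ H¹(Ω)` solves `-div(u∇y) = f` in `H⁻¹(Ω)` and `y = g` on `∂Ω`. -/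
def IsSolution {d : ℕ} {Ω : Set (E d)} (u : LInf Ω) (f : HNeg1 Ω) (g : L2Bdry Ω) (y : H1 Ω) :
    Prop :=
  (∀ φ : H10 Ω, ∫ x in Ω, u x * inner ℝ (grad y x) (grad (φ : H1 Ω) x) = f φ) ∧ HasTrace y g

end

end Conductivity

/-!
The energy estimate for `y₁ - y₂` and the bound for `y₂` come from testing the equations against
differences of functions with the same trace, so everything rests on the fact that a function in
`H¹(Ω)` with zero trace lies in `H¹₀(Ω)`. No integration by parts with a normal field is used for
this. Slicing along a direction transversal to the boundary bounds `∫_Ω ∂_v F` by the `L²` norm of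
`F` on `∂Ω`, since each slice contributes a single boundary value of `F`, and the projection along
`v` does not increase Hausdorff measure by more than a constant factor. Consequently an `H¹` limit
of smooth functions whose boundary values tend to zero in `L²(∂Ω)` extends by zero to an `H¹`
function on the whole space; after localization, mollifying that extension with kernels shifted
into the inward cone of the boundary gives test functions on `Ω` converging to it.

The estimates themselves are those of a coercive operator `A`, here multiplication by `u`: existence
by Lax-Milgram, and `⟪A₁ (∇y₁ - ∇y₂), ∇y₁ - ∇y₂⟫ = -⟪(A₁ - A₂) ∇y₂, ∇y₁ - ∇y₂⟫` for the
stability.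
-/

namespace Conductivity

noncomputable section

section Calculus

variable {V : Type*} [NormedAddCommGroup V] [NormedSpace ℝ V]

lemma fderiv_fun_mul_apply {f g : V → ℝ} {x : V} (hf : DifferentiableAt ℝ f x)
    (hg : DifferentiableAt ℝ g x) (v : V) :
    fderiv ℝ (fun z => f z * g z) x v = f x * fderiv ℝ g x v + fderiv ℝ f x v * g x := by
  rw [fderiv_fun_mul hf hg]
  simp [mul_comm]

lemma integral_fderiv_apply_eq_zero [MeasurableSpace V] [BorelSpace V] [FiniteDimensional ℝ V]
    {μ : Measure V} [μ.IsAddHaarMeasure] {f : V → ℝ} (hf : ContDiff ℝ 1 f)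
    (hf' : HasCompactSupport f) (v : V) : ∫ x, fderiv ℝ f x v ∂μ = 0 := by
  have hcont : Continuous fun x => fderiv ℝ f x v :=
    (hf.continuous_fderiv one_ne_zero).clm_apply continuous_const
  have hint := hcont.integrable_of_hasCompactSupport (μ := μ) (hf'.fderiv_apply ℝ v)
  simpa using integral_mul_fderiv_eq_neg_fderiv_mul_of_integrable (𝕜 := ℝ) (μ := μ) (v := v)
    (f := fun _ => (1 : ℝ)) (g := f) (by simp) (by simpa using hint)
    (by simpa using hf.continuous.integrable_of_hasCompactSupport hf')
    (fun x _ => differentiableAt_const _) (fun x _ => hf.differentiable one_ne_zero x)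

lemma inner_gradient {H : Type*} [NormedAddCommGroup H] [InnerProductSpace ℝ H] [CompleteSpace H]
    (f : H → ℝ) (x v : H) : inner ℝ (gradient f x) v = fderiv ℝ f x v := by
  simp [gradient]

end Calculus

section Poincare

lemma norm_sq_eq_integral_of_ae_eq {α F : Type*} [MeasurableSpace α] {μ : Measure α}
    [NormedAddCommGroup F] [InnerProductSpace ℝ F] {X : Lp F 2 μ} {f : α → F} (h : X =ᵐ[μ] f) :
    ‖X‖ ^ 2 = ∫ x, ‖f x‖ ^ 2 ∂μ := by
  rw [← real_inner_self_eq_norm_sq, L2.inner_def]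
  refine integral_congr_ae ?_
  filter_upwards [h] with x hx
  rw [hx, real_inner_self_eq_norm_sq]

variable {H : Type*} [NormedAddCommGroup H] [InnerProductSpace ℝ H]

lemma sq_div_two_sub_le_sq_add_inner_mul_fderiv {φ : H → ℝ} {R : ℝ}
    (hR : ∀ x ∈ tsupport φ, ‖x‖ ≤ R) {e : H} (he : ‖e‖ = 1) (x : H) :
    φ x ^ 2 / 2 - 2 * R ^ 2 * ‖fderiv ℝ φ x‖ ^ 2 ≤
      φ x ^ 2 + 2 * (inner ℝ e x * φ x * fderiv ℝ φ x e) := by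
  by_cases hx : x ∈ tsupport φ
  · have h₁ : |inner ℝ e x| ≤ R := by
      simpa only [he, one_mul] using (abs_real_inner_le_norm e x).trans
        (mul_le_mul_of_nonneg_left (hR x hx) (norm_nonneg e))
    have h₂ : |fderiv ℝ φ x e| ≤ ‖fderiv ℝ φ x‖ := by
      simpa [he] using (fderiv ℝ φ x).le_opNorm e
    have h₃ : (inner ℝ e x * fderiv ℝ φ x e) ^ 2 ≤ (R * ‖fderiv ℝ φ x‖) ^ 2 := by
      refine sq_le_sq.2 (le_trans ?_ (le_abs_self _))
      rw [abs_mul]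
      exact mul_le_mul h₁ h₂ (abs_nonneg _) ((abs_nonneg _).trans h₁)
    nlinarith [sq_nonneg (φ x + 2 * (inner ℝ e x * fderiv ℝ φ x e))]
  · have h₁ : φ x = 0 := image_eq_zero_of_notMem_tsupport hx
    have h₂ : fderiv ℝ φ x = 0 :=
      image_eq_zero_of_notMem_tsupport fun h => hx (tsupport_fderiv_subset ℝ h)
    simp only [h₁, h₂, norm_zero, zero_apply]
    norm_num

variable [FiniteDimensional ℝ H] [MeasurableSpace H] [BorelSpace H]

-- `0 = ∫ ∂ₑ(ℓ φ²) = ∫ (φ² + 2 ℓ φ ∂ₑφ)` for `ℓ x = ⟪e, x⟫`.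
lemma integral_sq_add_inner_mul_fderiv_eq_zero {φ : H → ℝ} (hφ : ContDiff ℝ 1 φ)
    (hφ' : HasCompactSupport φ) {e : H} (he : ‖e‖ = 1) :
    ∫ x, (φ x ^ 2 + 2 * (inner ℝ e x * φ x * fderiv ℝ φ x e)) = 0 := by
  let ℓ : H →L[ℝ] ℝ := innerSL ℝ e
  have hφφ : ContDiff ℝ 1 fun x => φ x * φ x := hφ.mul hφ
  rw [← integral_fderiv_apply_eq_zero (μ := volume) (ℓ.contDiff.mul hφφ)
    hφ'.mul_left.mul_left e]
  refine integral_congr_ae (ae_of_all _ fun x => ?_)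
  have hd := hφ.differentiable one_ne_zero x
  have hℓ : ℓ e = 1 := by simp [ℓ, he]
  beta_reduce
  rw [fderiv_fun_mul_apply ℓ.differentiableAt (hd.fun_mul hd), fderiv_fun_mul_apply hd hd,
    ContinuousLinearMap.fderiv, hℓ, innerSL_apply_apply]
  ring

lemma integral_sq_le_mul_integral_norm_fderiv_sq [Nontrivial H] {φ : H → ℝ} (hφ : ContDiff ℝ 1 φ)
    (hφ' : HasCompactSupport φ) {R : ℝ} (hR : ∀ x ∈ tsupport φ, ‖x‖ ≤ R) :
    ∫ x, φ x ^ 2 ≤ (2 * R) ^ 2 * ∫ x, ‖fderiv ℝ φ x‖ ^ 2 := by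
  obtain ⟨e, he⟩ := exists_norm_eq H zero_le_one
  have hc := hφ.continuous
  have hc' := hφ.continuous_fderiv one_ne_zero
  have hint : Integrable fun x => φ x ^ 2 :=
    Continuous.integrable_of_hasCompactSupport (by fun_prop)
      (hφ'.comp_left (g := fun t => t ^ 2) (zero_pow two_ne_zero))
  have hint' : Integrable fun x => ‖fderiv ℝ φ x‖ ^ 2 :=
    Continuous.integrable_of_hasCompactSupport (hc'.norm.pow 2)
      ((hφ'.fderiv ℝ).comp_left (g := fun L => ‖L‖ ^ 2) (by simp))
  have hint'' : Integrable fun x => inner ℝ e x * φ x * fderiv ℝ φ x e :=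
    Continuous.integrable_of_hasCompactSupport (by fun_prop) hφ'.mul_left.mul_right
  have hle : (∫ x, φ x ^ 2) / 2 - 2 * R ^ 2 * ∫ x, ‖fderiv ℝ φ x‖ ^ 2 ≤ 0 :=
    calc _ = ∫ x, (φ x ^ 2 / 2 - 2 * R ^ 2 * ‖fderiv ℝ φ x‖ ^ 2) := by
          rw [integral_sub (hint.div_const 2) (hint'.const_mul _), integral_div,
            integral_const_mul]
      _ ≤ ∫ x, (φ x ^ 2 + 2 * (inner ℝ e x * φ x * fderiv ℝ φ x e)) :=
          integral_mono ((hint.div_const 2).sub (hint'.const_mul _))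
            (hint.add (hint''.const_mul 2)) (sq_div_two_sub_le_sq_add_inner_mul_fderiv hR he)
      _ = 0 := integral_sq_add_inner_mul_fderiv_eq_zero hφ hφ' he
  linarith

end Poincare

section Coercive

variable {X : Type*} [NormedAddCommGroup X] [InnerProductSpace ℝ X] {A B : X →L[ℝ] X}
  {C m M k : ℝ}

lemma mul_norm_le_of_inner_le {x : X} {c : ℝ} (hc : 0 ≤ c)
    (hA : m * ‖x‖ ^ 2 ≤ inner ℝ (A x) x) (h : inner ℝ (A x) x ≤ c * ‖x‖) : m * ‖x‖ ≤ c := by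
  rcases (norm_nonneg x).eq_or_lt with hx | hx
  · rwa [← hx, mul_zero]
  · refine le_of_mul_le_mul_right ?_ hx
    rw [mul_assoc, ← sq]
    exact hA.trans h

lemma mul_norm_le_of_inner_sub_eq_zero (hM : 0 ≤ M) (hA : ∀ x, m * ‖x‖ ^ 2 ≤ inner ℝ (A x) x)
    (hAM : ∀ x, ‖A x‖ ≤ M * ‖x‖) {x z : X} (h : inner ℝ (A x) (x - z) = 0) :
    m * ‖x‖ ≤ M * ‖z‖ := by
  refine mul_norm_le_of_inner_le (by positivity) (hA x) ?_
  calc inner ℝ (A x) x = inner ℝ (A x) z := sub_eq_zero.1 ((inner_sub_right ..).symm.trans h)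
    _ ≤ M * ‖x‖ * ‖z‖ := (real_inner_le_norm _ _).trans (by gcongr; exact hAM x)
    _ = M * ‖z‖ * ‖x‖ := by ring

lemma mul_norm_sub_le_of_inner_sub_eq (hk : 0 ≤ k) (hA : ∀ x, m * ‖x‖ ^ 2 ≤ inner ℝ (A x) x)
    (hAB : ∀ x, ‖A x - B x‖ ≤ k * ‖x‖) {x z : X}
    (h : inner ℝ (A x) (x - z) = inner ℝ (B z) (x - z)) : m * ‖x - z‖ ≤ k * ‖z‖ := by
  refine mul_norm_le_of_inner_le (by positivity) (hA _) ?_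
  calc inner ℝ (A (x - z)) (x - z) = -inner ℝ (A z - B z) (x - z) := by
        rw [map_sub, inner_sub_left, inner_sub_left, h, neg_sub]
    _ ≤ ‖A z - B z‖ * ‖x - z‖ := (neg_le_abs _).trans (abs_real_inner_le_norm _ _)
    _ ≤ k * ‖z‖ * ‖x - z‖ := by gcongr; exact hAB z

lemma exists_forall_inner_eq_of_coercive {V : Type*} [NormedAddCommGroup V]
    [InnerProductSpace ℝ V] [CompleteSpace V] {D : V →L[ℝ] X} (hC : 0 < C)
    (hD : ∀ w, ‖w‖ ≤ C * ‖D w‖) (hm : 0 < m) (hA : ∀ x, m * ‖x‖ ^ 2 ≤ inner ℝ (A x) x)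
    (f : StrongDual ℝ V) : ∃ w, ∀ φ, inner ℝ (A (D w)) (D φ) = f φ := by
  let b : V →L[ℝ] V →L[ℝ] ℝ := (innerSL ℝ).bilinearComp (A ∘L D) D
  have hb : IsCoercive b := by
    refine ⟨m / C ^ 2, by positivity, fun w => ?_⟩
    calc m / C ^ 2 * ‖w‖ * ‖w‖ = m / C ^ 2 * ‖w‖ ^ 2 := by ring
      _ ≤ m / C ^ 2 * (C * ‖D w‖) ^ 2 := by gcongr; exact hD w
      _ = m * ‖D w‖ ^ 2 := by field_simp
      _ ≤ b w w := hA (D w)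
  refine ⟨hb.continuousLinearEquivOfBilin.symm ((InnerProductSpace.toDual ℝ _).symm f),
    fun φ => ?_⟩
  change b _ φ = f φ
  rw [← hb.continuousLinearEquivOfBilin_apply, ContinuousLinearEquiv.apply_symm_apply,
    InnerProductSpace.toDual_symm_apply]

variable {W : Type*} [NormedAddCommGroup W] [InnerProductSpace ℝ W] {V : Submodule ℝ W}
  {D : W →L[ℝ] X}

lemma exists_mem_forall_inner_add_eq_of_coercive [CompleteSpace V] (hC : 0 < C)
    (hD : ∀ w ∈ V, ‖w‖ ≤ C * ‖D w‖) (hm : 0 < m) (hA : ∀ x, m * ‖x‖ ^ 2 ≤ inner ℝ (A x) x)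
    (z : W) (f : StrongDual ℝ V) :
    ∃ w ∈ V, ∀ φ : V, inner ℝ (A (D (z + w))) (D φ) = f φ := by
  obtain ⟨w, hw⟩ := exists_forall_inner_eq_of_coercive (D := D ∘L V.subtypeL) hC
    (fun w => hD w w.2) hm hA (f - innerSL ℝ (A (D z)) ∘L D ∘L V.subtypeL)
  refine ⟨w, w.2, fun φ => ?_⟩
  rw [map_add, map_add, inner_add_left]
  exact eq_sub_iff_add_eq'.1 (hw φ)

lemma abs_apply_le_sInf_mul_norm (hC : 0 ≤ C) (hD : ∀ w ∈ V, ‖w‖ ≤ C * ‖D w‖)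
    (f : StrongDual ℝ V) (φ : V) :
    |f φ| ≤ sInf {c | 0 ≤ c ∧ ∀ φ : V, |f φ| ≤ c * ‖D φ‖} * ‖D φ‖ := by
  have hmem : 0 ≤ ‖f‖ * C ∧ ∀ φ : V, |f φ| ≤ ‖f‖ * C * ‖D φ‖ :=
    ⟨by positivity, fun φ => (f.le_opNorm φ).trans <| by
      rw [mul_assoc]
      exact mul_le_mul_of_nonneg_left (hD φ φ.2) (norm_nonneg f)⟩
  rcases (norm_nonneg (D φ)).eq_or_lt with hφ | hφ
  · simpa [← hφ] using hmem.2 φ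
  · exact (div_le_iff₀ hφ).1 (le_csInf ⟨_, hmem⟩ fun c hc => (div_le_iff₀ hφ).2 (hc.2 φ))

end Coercive

section Mollification

open scoped Convolution
open ContinuousLinearMap (lsmul)

lemma eLpNorm_integral_le_of_ae_le {α β F : Type*} [MeasurableSpace α] [MeasurableSpace β]
    [NormedAddCommGroup F] [NormedSpace ℝ F] {μ : Measure α} [SFinite μ] {ν : Measure β}
    [IsProbabilityMeasure ν] {p : ℝ≥0} (hp : 1 ≤ p) {g : α → β → F}
    (hg : StronglyMeasurable (Function.uncurry g)) {ε : ℝ≥0∞}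
    (h : ∀ᵐ s ∂ν, eLpNorm (fun x => g x s) p μ ≤ ε) :
    eLpNorm (fun x => ∫ s, g x s ∂ν) p μ ≤ ε := by
  have hp₀ : p ≠ 0 := (zero_lt_one.trans_le hp).ne'
  have hjensen : ∀ x, ‖∫ s, g x s ∂ν‖ₑ ^ (p : ℝ) ≤ ∫⁻ s, ‖g x s‖ₑ ^ (p : ℝ) ∂ν := fun x => by
    rw [← eLpNorm_nnreal_pow_eq_lintegral hp₀]
    gcongr
    calc ‖∫ s, g x s ∂ν‖ₑ ≤ eLpNorm (g x) 1 ν :=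
          (enorm_integral_le_lintegral_enorm _).trans_eq eLpNorm_one_eq_lintegral_enorm.symm
      _ ≤ eLpNorm (g x) p ν := eLpNorm_le_eLpNorm_of_exponent_le (by exact_mod_cast hp)
          (hg.comp_measurable measurable_prodMk_left).aestronglyMeasurable
  rw [← ENNReal.rpow_le_rpow_iff (z := p) (by positivity), eLpNorm_nnreal_pow_eq_lintegral hp₀]
  calc ∫⁻ x, ‖∫ s, g x s ∂ν‖ₑ ^ (p : ℝ) ∂μ ≤ ∫⁻ x, ∫⁻ s, ‖g x s‖ₑ ^ (p : ℝ) ∂ν ∂μ :=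
        lintegral_mono hjensen
    _ = ∫⁻ s, ∫⁻ x, ‖g x s‖ₑ ^ (p : ℝ) ∂μ ∂ν :=
        lintegral_lintegral_swap (hg.enorm.pow_const _).aemeasurable
    _ ≤ ∫⁻ _, ε ^ (p : ℝ) ∂ν := by
        refine lintegral_mono_ae (h.mono fun s hs => ?_)
        rw [← eLpNorm_nnreal_pow_eq_lintegral hp₀]
        gcongr
    _ = ε ^ (p : ℝ) := by rw [lintegral_const, measure_univ, mul_one]

variable {G F : Type*} [NormedAddCommGroup G] [NormedSpace ℝ G] [FiniteDimensional ℝ G]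
  [MeasurableSpace G] [BorelSpace G] {μ : Measure G} [μ.IsAddHaarMeasure] [NormedAddCommGroup F]

lemma tendsto_eLpNorm_translate_sub {p : ℝ≥0∞} [Fact (1 ≤ p)] (hp : p ≠ ⊤) {f : G → F}
    (hf : MemLp f p μ) :
    Tendsto (fun s => eLpNorm (fun x => f (x - s) - f x) p μ) (𝓝 0) (𝓝 0) := by
  let τ : C(G, C(G, G)) := (ContinuousMap.mk fun q : G × G => q.2 - q.1).curry
  have hτ : ∀ s, MeasurePreserving (τ s) μ μ := measurePreserving_sub_right μ
  have hcont := (tendsto_const_nhds (x := hf.toLp f)).compMeasurePreservingLp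
    (τ.continuous.tendsto 0) hτ (hτ 0) hp
  have h₀ : Lp.compMeasurePreserving (τ 0) (hτ 0) (hf.toLp f) = hf.toLp f :=
    (Lp.toLp_compMeasurePreserving hf (hτ 0)).trans
      (MemLp.toLp_congr _ _ (ae_of_all _ fun x => congrArg f (sub_zero x)))
  rw [h₀, tendsto_iff_edist_tendsto_0] at hcont
  simp only [Lp.toLp_compMeasurePreserving, Lp.edist_toLp_toLp] at hcont
  exact hcont

variable [NormedSpace ℝ F]

lemma fderiv_convolution_lsmul_apply {η : G → ℝ} (hηs : HasCompactSupport η)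
    (hη : ContDiff ℝ 1 η) {f : G → F} (hf : LocallyIntegrable f μ) (x v : G) :
    fderiv ℝ (η ⋆[lsmul ℝ ℝ, μ] f) x v = ((fun t => fderiv ℝ η t v) ⋆[lsmul ℝ ℝ, μ] f) x := by
  rw [← convolution_flip (L := lsmul ℝ ℝ) (f := η), ← convolution_flip (L := lsmul ℝ ℝ),
    (hηs.hasFDerivAt_convolution_right (lsmul ℝ ℝ).flip hf hη x).fderiv,
    convolution_precompR_apply _ hf (hηs.fderiv ℝ) (hη.continuous_fderiv one_ne_zero)]

lemma eLpNorm_normed_convolution_sub_le [CompleteSpace F] {c : G} (b : ContDiffBump c)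
    {p : ℝ≥0} (hp : 1 ≤ p) {f : G → F} (hf : MemLp f p μ) (hfm : StronglyMeasurable f) {ε : ℝ≥0∞}
    (hε : ∀ s ∈ Metric.ball c b.rOut, eLpNorm (fun x => f (x - s) - f x) p μ ≤ ε) :
    eLpNorm (fun x => (b.normed μ ⋆[lsmul ℝ ℝ, μ] f) x - f x) p μ ≤ ε := by
  have hη : Measurable fun s => (b.normed μ s).toNNReal :=
    b.continuous_normed.measurable.real_toNNReal
  have hη' : ∀ s, ((b.normed μ s).toNNReal : ℝ) = b.normed μ s := fun s =>
    Real.coe_toNNReal _ (b.nonneg_normed s)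
  let ν : Measure G := μ.withDensity fun s => (b.normed μ s).toNNReal
  have hν : IsProbabilityMeasure ν := ⟨by
    rw [withDensity_apply _ MeasurableSet.univ, setLIntegral_univ]
    change ∫⁻ x, ENNReal.ofReal (b.normed μ x) ∂μ = 1
    rw [← ofReal_integral_eq_lintegral_ofReal b.integrable_normed
      (ae_of_all _ fun s => b.nonneg_normed s),
      b.integral_normed, ENNReal.ofReal_one]⟩
  have hνball : ∀ᵐ s ∂ν, s ∈ Metric.ball c b.rOut := by
    refine (ae_withDensity_iff hη.coe_nnreal_ennreal).2 (ae_of_all _ fun s hs => ?_)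
    rw [← b.support_normed_eq (μ := μ), Function.mem_support, ← hη' s]
    exact_mod_cast hs
  have hconv := (b.hasCompactSupport_normed (μ := μ)).convolutionExists_left (lsmul ℝ ℝ)
    b.continuous_normed (hf.locallyIntegrable (by exact_mod_cast hp))
  have hint : ∀ x, Integrable (fun s => f (x - s)) ν := fun x => by
    rw [integrable_withDensity_iff_integrable_smul hη]
    refine (hconv x).congr (ae_of_all _ fun s => ?_)
    simp [NNReal.smul_def, hη']
  have hmean (x : G) : (b.normed μ ⋆[lsmul ℝ ℝ, μ] f) x - f x = ∫ s, (f (x - s) - f x) ∂ν := by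
    rw [integral_sub (hint x) (integrable_const _), integral_const, probReal_univ, one_smul,
      integral_withDensity_eq_integral_smul hη]
    simp [NNReal.smul_def, hη', convolution_def]
  simp_rw [hmean]
  exact eLpNorm_integral_le_of_ae_le hp
    ((hfm.comp_measurable (measurable_fst.sub measurable_snd)).sub
      (hfm.comp_measurable measurable_fst)) (hνball.mono hε)

end Mollification

section InwardCone

variable {X : Type*} [NormedAddCommGroup X] [NormedSpace ℝ X]

lemma exists_isOpen_forall_add_lt {ρ : X → ℝ} {ℓ : X →L[ℝ] ℝ} {x₀ : X}
    (hρ : HasStrictFDerivAt ρ ℓ x₀) (hℓ : ℓ ≠ 0) {W : Set X} (hW : W ∈ 𝓝 x₀) :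
    ∃ V ∈ 𝓝 x₀, ∃ N, IsOpen N ∧ 0 ∈ closure N ∧
      ∀ z ∈ V, ∀ s ∈ N, z + s ∈ W ∧ ρ (z + s) < ρ z := by
  obtain ⟨v, hv⟩ : ∃ v, ℓ v < 0 := by
    obtain ⟨v, hv⟩ := DFunLike.ne_iff.1 hℓ
    exact (lt_or_gt_of_ne hv).elim (fun h => ⟨v, h⟩) fun h => ⟨-v, by simpa using h⟩
  obtain ⟨c, hc, hcv⟩ : ∃ c > 0, ℓ v + c * ‖v‖ < 0 := by
    have hlim : Tendsto (fun c : ℝ => ℓ v + c * ‖v‖) (𝓝[>] 0) (𝓝 (ℓ v + 0 * ‖v‖)) :=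
      (Continuous.tendsto (by fun_prop) 0).mono_left nhdsWithin_le_nhds
    obtain ⟨c, hlt, hc⟩ := ((hlim.eventually_lt_const (by simpa using hv)).and
      self_mem_nhdsWithin).exists
    exact ⟨c, hc, hlt⟩
  have hadd : Tendsto (fun p : X × X => (p.1 + p.2, p.1)) (𝓝 (x₀, 0)) (𝓝 (x₀, x₀)) := by
    have h : Continuous fun p : X × X => (p.1 + p.2, p.1) := by fun_prop
    simpa using h.tendsto (x₀, 0)
  have hnear : ∀ᶠ p in 𝓝 (x₀, (0 : X)), p.1 + p.2 ∈ W ∧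
      ‖ρ (p.1 + p.2) - ρ p.1 - ℓ (p.1 + p.2 - p.1)‖ ≤ c * ‖p.1 + p.2 - p.1‖ :=
    hadd.eventually ((continuous_fst.continuousAt.eventually_mem hW).and (hρ.isLittleO.def hc))
  obtain ⟨V, hV, B, hB, hVB⟩ := mem_nhds_prod_iff.1 hnear
  refine ⟨V, hV, {s | ℓ s + c * ‖s‖ < 0} ∩ interior B,
    (isOpen_lt (by fun_prop) continuous_const).inter isOpen_interior, ?_, ?_⟩
  · have hlim : Tendsto (fun t : ℝ => t • v) (𝓝[>] 0) (𝓝 ((0 : ℝ) • v)) :=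
      (Continuous.tendsto (by fun_prop) 0).mono_left nhdsWithin_le_nhds
    rw [zero_smul] at hlim
    refine mem_closure_of_tendsto hlim ?_
    filter_upwards [hlim.eventually_mem (interior_mem_nhds.2 hB), self_mem_nhdsWithin] with t htB ht
    refine ⟨?_, htB⟩
    have ht : 0 < t := ht
    rw [mem_ofPred_eq, map_smul, norm_smul, Real.norm_of_nonneg ht.le, smul_eq_mul]
    linarith [mul_neg_of_pos_of_neg ht hcv]
  · rintro z hz s ⟨hs, hsB⟩
    obtain ⟨hW, hle⟩ := hVB (mk_mem_prod hz (interior_subset hsB))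
    refine ⟨hW, ?_⟩
    rw [add_sub_cancel_left] at hle
    have hs : ℓ s + c * ‖s‖ < 0 := hs
    linarith [(Real.le_norm_self _).trans hle]

lemma exists_closedBall_of_mem_closure {X : Type*} [PseudoMetricSpace X] {N : Set X} {x₀ : X}
    (hN : IsOpen N) (hx₀ : x₀ ∈ closure N) {p : X → Prop} (hp : ∀ᶠ x in 𝓝 x₀, p x) :
    ∃ c, ∃ r > 0, ∀ x ∈ Metric.closedBall c r, x ∈ N ∧ p x := by
  obtain ⟨c, hc, hpc⟩ :=
    ((mem_closure_iff_frequently.1 hx₀).and_eventually hp.eventually_nhds).exists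
  obtain ⟨r, hr, hball⟩ :=
    Metric.nhds_basis_closedBall.eventually_iff.1 ((hN.eventually_mem hc).and hpc)
  exact ⟨c, r, hr, fun x hx => hball hx⟩

end InwardCone

section Localization

lemma exists_cutoff {X : Type*} [NormedAddCommGroup X] [NormedSpace ℝ X]
    [FiniteDimensional ℝ X] {K : Set X} (hK : IsCompact K) {P : (X → ℝ) → Prop} (h0 : P 0)
    (hadd : ∀ a b, P a → P b → P (a + b))
    (hloc : ∀ x ∈ K, ∃ V ∈ 𝓝 x, ∀ χ, ContDiff ℝ ∞ χ → HasCompactSupport χ → tsupport χ ⊆ V →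
      P χ) :
    ∃ χ : X → ℝ, ContDiff ℝ ∞ χ ∧ (∀ x ∈ K, χ x = 1) ∧ P χ := by
  suffices ∃ χ : X → ℝ, ContDiff ℝ ∞ χ ∧ (∀ x ∈ K, χ x = 1) ∧
      ∀ ψ : X → ℝ, ContDiff ℝ ∞ ψ → P (χ * ψ) by
    obtain ⟨χ, hχ, hχ1, hP⟩ := this
    exact ⟨χ, hχ, hχ1, by simpa using hP 1 contDiff_const⟩
  refine hK.induction_on (p := fun s => ∃ χ : X → ℝ, ContDiff ℝ ∞ χ ∧ (∀ x ∈ s, χ x = 1) ∧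
      ∀ ψ : X → ℝ, ContDiff ℝ ∞ ψ → P (χ * ψ)) ?_ ?_ ?_ ?_
  · exact ⟨0, contDiff_const, by simp, fun ψ _ => by simpa using h0⟩
  · rintro s t hst ⟨χ, hχ, hχ1, hP⟩
    exact ⟨χ, hχ, fun x hx => hχ1 x (hst hx), hP⟩
  · rintro s t ⟨χ, hχ, hχ1, hPχ⟩ ⟨θ, hθ, hθ1, hPθ⟩
    have hχ' : ContDiff ℝ ∞ (1 - χ) := contDiff_const.sub hχ
    refine ⟨χ + θ * (1 - χ), hχ.add (hθ.mul hχ'), ?_, fun ψ hψ => ?_⟩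
    · rintro x (hx | hx)
      · simp [hχ1 x hx]
      · simp [hθ1 x hx]
    · rw [add_mul, mul_assoc]
      exact hadd _ _ (hPχ ψ hψ) (hPθ _ (hχ'.mul hψ))
  · intro x hx
    obtain ⟨V, hV, hP⟩ := hloc x hx
    obtain ⟨r, hr, hrV⟩ := Metric.nhds_basis_closedBall.mem_iff.1 hV
    let b : ContDiffBump x := ⟨r / 2, r, by positivity, by linarith⟩
    exact ⟨Metric.closedBall x (r / 2),
      mem_nhdsWithin_of_mem_nhds (Metric.closedBall_mem_nhds x (by positivity)), b, b.contDiff,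
      fun z hz => b.one_of_mem_closedBall hz, fun ψ hψ => hP _ (b.contDiff.mul hψ)
        b.hasCompactSupport.mul_right ((tsupport_mul_subset_left.trans_eq b.tsupport_eq).trans hrV)⟩

end Localization

section LipschitzImage

variable {X Y F G : Type*} [MeasurableSpace X] [MeasurableSpace Y] [NormedAddCommGroup F]
  [NormedAddCommGroup G] {π : X → Y} {p : ℝ≥0∞}

lemma eLpNorm_map_le_of_forall_enorm_le {μ : Measure X} {f : Y → F} {g : X → G}
    (hp₀ : p ≠ 0) (hp : p ≠ ⊤) (hfg : ∀ᵐ x ∂μ, ‖f (π x)‖ₑ ≤ ‖g x‖ₑ) :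
    eLpNorm f p (μ.map π) ≤ eLpNorm g p μ := by
  rw [eLpNorm_eq_lintegral_rpow_enorm_toReal hp₀ hp, eLpNorm_eq_lintegral_rpow_enorm_toReal hp₀ hp]
  gcongr ?_ ^ _
  refine (lintegral_map_le _ _).trans (lintegral_mono_ae (hfg.mono fun x hx => ?_))
  gcongr

variable [EMetricSpace X] [BorelSpace X] [EMetricSpace Y] [BorelSpace Y] {K : ℝ≥0} {k : ℝ}
  {Γ : Set X}

lemma restrict_image_hausdorffMeasure_le (hπ : LipschitzWith K π) (hk : 0 ≤ k) (Γ : Set X) :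
    (Measure.hausdorffMeasure k).restrict (π '' Γ) ≤
      (K : ℝ≥0∞) ^ k • ((Measure.hausdorffMeasure k).restrict Γ).map π := by
  refine Measure.le_iff.2 fun S hS => ?_
  rw [Measure.restrict_apply hS, Measure.smul_apply, smul_eq_mul,
    Measure.map_apply hπ.continuous.measurable hS,
    Measure.restrict_apply (hπ.continuous.measurable hS), ← image_preimage_inter]
  exact hπ.hausdorffMeasure_image_le hk _

lemma eLpNorm_restrict_image_hausdorffMeasure_le (hπ : LipschitzWith K π) (hk : 0 ≤ k)
    (hΓ : MeasurableSet Γ) {f : Y → F} {g : X → G} (hp₀ : p ≠ 0) (hp : p ≠ ⊤)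
    (hfg : ∀ x ∈ Γ, ‖f (π x)‖ₑ ≤ ‖g x‖ₑ) :
    eLpNorm f p ((Measure.hausdorffMeasure k).restrict (π '' Γ)) ≤
      ((K : ℝ≥0∞) ^ k) ^ (1 / p).toReal •
        eLpNorm g p ((Measure.hausdorffMeasure k).restrict Γ) := by
  refine (eLpNorm_le_of_measure_le_smul (restrict_image_hausdorffMeasure_le hπ hk Γ)).trans ?_
  gcongr
  exact eLpNorm_map_le_of_forall_enorm_le hp₀ hp (ae_restrict_of_forall_mem hΓ hfg)

lemma enorm_integral_le_eLpNorm_mul_of_support_subset {X G : Type*} [MeasurableSpace X]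
    [NormedAddCommGroup G] [NormedSpace ℝ G] {μ : Measure X} {f : X → G}
    (hf : AEStronglyMeasurable f μ) {s : Set X} (hs : Function.support f ⊆ s) {p : ℝ≥0∞}
    (hp : 1 ≤ p) :
    ‖∫ x, f x ∂μ‖ₑ ≤ eLpNorm f p (μ.restrict s) * μ s ^ (1 - 1 / p.toReal) :=
  calc ‖∫ x, f x ∂μ‖ₑ ≤ eLpNorm f 1 (μ.restrict s) := by
        rw [eLpNorm_restrict_eq_of_support_subset hs, eLpNorm_one_eq_lintegral_enorm]
        exact enorm_integral_le_lintegral_enorm f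
    _ ≤ _ := by
        simpa using eLpNorm_le_eLpNorm_mul_rpow_measure_univ hp (hf.restrict (s := s))

end LipschitzImage

section Slice

variable {g h : ℝ → ℝ} {A J : Set ℝ}

lemma integral_indicator_deriv_eq (hg : ContDiff ℝ 1 g) (hgc : HasCompactSupport g)
    (hgJ : ∀ t ∉ J, deriv g t = 0) {c : ℝ} (hA : ∀ t ∈ J, t ∈ A ↔ t < c) :
    ∫ t, A.indicator (deriv g) t = g c := by
  have hind : A.indicator (deriv g) = (Iio c).indicator (deriv g) := by
    funext t
    by_cases ht : t ∈ J
    · by_cases htc : t < c <;> simp [hA t ht, htc]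
    · simp [indicator_apply, hgJ t ht]
  rw [hind, integral_indicator measurableSet_Iio, ← integral_Iic_eq_integral_Iio,
    hgc.integral_Iic_deriv_eq hg]

lemma integral_indicator_deriv_eq_zero (hg : ContDiff ℝ 1 g) (hgc : HasCompactSupport g)
    (hgJ : ∀ t ∉ J, deriv g t = 0) (hJ : J.OrdConnected) (hh : ContinuousOn h J)
    (hh₀ : ∀ t ∈ J, h t ≠ 0) (hA : ∀ t ∈ J, t ∈ A ↔ h t < 0) :
    ∫ t, A.indicator (deriv g) t = 0 := by
  by_cases hJA : J ⊆ A
  · have hind : A.indicator (deriv g) = deriv g :=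
      indicator_eq_self.2 fun t ht => hJA (by_contra fun htJ => ht (hgJ t htJ))
    simpa [hind] using integral_fderiv_apply_eq_zero (μ := volume) hg hgc 1
  · obtain ⟨a, haJ, haA⟩ := not_subset.1 hJA
    refine integral_eq_zero_of_ae (ae_of_all _ fun t => ?_)
    refine indicator_apply_eq_zero.2 fun htA => by_contra fun ht => ?_
    have htJ : t ∈ J := by_contra fun htJ => ht (hgJ t htJ)
    obtain ⟨s, hsJ, hs⟩ := hJ.isPreconnected.intermediate_value htJ haJ hh
      ⟨((hA t htJ).1 htA).le, not_lt.1 (mt (hA a haJ).2 haA)⟩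
    exact hh₀ s hsJ hs

end Slice

lemma nonpos_of_mem_closure {X : Type*} [TopologicalSpace X] {Ω V : Set X} (hV : IsOpen V)
    {ρ : X → ℝ} (hρ : ContinuousOn ρ V) (hΩV : Ω ∩ V = {z ∈ V | ρ z < 0}) {z : X}
    (hz : z ∈ closure Ω) (hzV : z ∈ V) : ρ z ≤ 0 := by
  have hV' := hV.mem_nhds hzV
  have : ∃ᶠ x in 𝓝 z, ρ x ≤ 0 := ((mem_closure_iff_frequently.1 hz).and_eventually hV').mono
    fun x hx => (hΩV.subset hx).2.le
  exact le_of_tendsto_of_frequently (hρ.continuousAt hV') this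

section Sublevel

variable {X : Type*} [NormedAddCommGroup X] [NormedSpace ℝ X]

lemma mem_frontier_iff_eq_zero {Ω V : Set X} (hΩ : IsOpen Ω) (hV : IsOpen V) {ρ : X → ℝ}
    (hρ : ContinuousOn ρ V) (hΩV : Ω ∩ V = {z ∈ V | ρ z < 0}) {z : X} (hzV : z ∈ V)
    (hz : fderiv ℝ ρ z ≠ 0) : z ∈ frontier Ω ↔ ρ z = 0 := by
  rw [hΩ.frontier_eq]
  refine ⟨fun h => ?_, fun h => ⟨by_contra fun hcl => hz ?_, fun hzΩ => ?_⟩⟩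
  · exact (nonpos_of_mem_closure hV hρ hΩV h.1 hzV).antisymm
      (not_lt.1 fun hlt => h.2 (hΩV.superset ⟨hzV, hlt⟩).1)
  · refine IsLocalMin.fderiv_eq_zero ?_
    filter_upwards [isClosed_closure.isOpen_compl.mem_nhds hcl, hV.mem_nhds hzV] with x hx hxV
    exact h.trans_le (not_lt.1 fun hlt => hx (subset_closure (hΩV.superset ⟨hxV, hlt⟩).1))
  · exact (hΩV.subset ⟨hzΩ, hzV⟩).2.ne h

lemma frontier_inter_eq {Ω V : Set X} (hΩ : IsOpen Ω) (hV : IsOpen V) {ρ : X → ℝ}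
    (hρ : ContinuousOn ρ V) (hΩV : Ω ∩ V = {z ∈ V | ρ z < 0}) (hV' : ∀ z ∈ V, fderiv ℝ ρ z ≠ 0) :
    frontier Ω ∩ V = {z ∈ V | ρ z = 0} :=
  ext fun z => and_comm.trans <| and_congr_right fun hz =>
    mem_frontier_iff_eq_zero hΩ hV hρ hΩV hz (hV' z hz)

end Sublevel

section Splitting

variable {X W : Type*} [NormedAddCommGroup X] [NormedSpace ℝ X] [NormedAddCommGroup W]
  [NormedSpace ℝ W] (e : X ≃L[ℝ] ℝ × W)

lemma exists_integral_eq_mul_integral_integral [FiniteDimensional ℝ X] [MeasurableSpace X]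
    [BorelSpace X] [FiniteDimensional ℝ W] [MeasurableSpace W] [BorelSpace W] (μ : Measure X)
    [μ.IsAddHaarMeasure] (ν : Measure W) [ν.IsAddHaarMeasure] :
    ∃ c : ℝ≥0, ∀ f : X → ℝ, Integrable f μ →
      Integrable (fun w => ∫ t, f (e.symm (t, w))) ν ∧
        ∫ x, f x ∂μ = c * ∫ w, (∫ t, f (e.symm (t, w))) ∂ν := by
  let μ' : Measure X := Measure.map e.symm ((volume : Measure ℝ).prod ν)
  have : μ'.IsAddHaarMeasure := e.symm.isAddHaarMeasure_map _
  have hemb : MeasurableEmbedding e.symm := e.symm.toHomeomorph.measurableEmbedding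
  refine ⟨μ.addHaarScalarFactor μ', fun f hf => ?_⟩
  have hf' : Integrable (fun p : ℝ × W => f (e.symm p)) ((volume : Measure ℝ).prod ν) := by
    refine hemb.integrable_map_iff.1 ?_
    rw [show Measure.map e.symm _ = μ' from rfl, Measure.isAddLeftInvariant_eq_smul μ' μ]
    exact hf.smul_measure_nnreal
  refine ⟨hf'.integral_prod_right, ?_⟩
  conv_lhs => rw [Measure.isAddLeftInvariant_eq_smul μ μ']
  rw [integral_smul_nnreal_measure, hemb.integral_map, integral_prod_symm _ hf']
  rfl

variable {e}

lemma hasDerivAt_comp_line {f : X → ℝ} {t : ℝ} {w : W}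
    (hf : DifferentiableAt ℝ f (e.symm (t, w))) :
    HasDerivAt (fun t => f (e.symm (t, w))) (fderiv ℝ f (e.symm (t, w)) (e.symm (1, 0))) t := by
  have hline : HasDerivAt (fun t : ℝ => ((t, w) : ℝ × W)) (1, 0) t :=
    (hasDerivAt_id t).prodMk (hasDerivAt_const t w)
  exact hf.hasFDerivAt.comp_hasDerivAt t
    ((e.symm : ℝ × W →L[ℝ] X).hasFDerivAt.comp_hasDerivAt t hline)

lemma convex_line_preimage {B : Set X} (hB : Convex ℝ B) (w : W) :
    Convex ℝ {t : ℝ | e.symm (t, w) ∈ B} :=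
  hB.affine_preimage ((e.symm.toLinearEquiv : ℝ × W →ₗ[ℝ] X).toAffineMap.comp
    ((AffineMap.id ℝ ℝ).prod (AffineMap.const ℝ ℝ w)))

lemma strictMonoOn_comp_line {B : Set X} (hB : Convex ℝ B) {ρ : X → ℝ}
    (hρ : ∀ z ∈ B, DifferentiableAt ℝ ρ z) (hpos : ∀ z ∈ B, 0 < fderiv ℝ ρ z (e.symm (1, 0)))
    (w : W) : StrictMonoOn (fun t => ρ (e.symm (t, w))) {t | e.symm (t, w) ∈ B} := by
  refine strictMonoOn_of_deriv_pos (convex_line_preimage hB w)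
    (fun t ht => (hasDerivAt_comp_line (hρ _ ht)).continuousAt.continuousWithinAt) fun t ht => ?_
  have ht := interior_subset ht
  rw [(hasDerivAt_comp_line (hρ _ ht)).deriv]
  exact hpos _ ht

end Splitting

variable {d : ℕ} {Ω : Set (E d)}

lemma norm_sq_eq (y : H1 Ω) : ‖y‖ ^ 2 = ‖fn y‖ ^ 2 + ‖grad y‖ ^ 2 :=
  WithLp.prod_norm_sq_eq_of_L2 (y : WithLp 2 (L2 Ω × L2Vec Ω))

lemma norm_fn_le (y : H1 Ω) : ‖fn y‖ ≤ ‖y‖ := by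
  refine (sq_le_sq₀ (norm_nonneg _) (norm_nonneg _)).1 ?_
  rw [norm_sq_eq]
  exact le_add_of_nonneg_right (sq_nonneg _)

lemma norm_grad_le (y : H1 Ω) : ‖grad y‖ ≤ ‖y‖ := by
  refine (sq_le_sq₀ (norm_nonneg _) (norm_nonneg _)).1 ?_
  rw [norm_sq_eq]
  exact le_add_of_nonneg_left (sq_nonneg _)

/-- `fn` as a continuous linear map `H¹(Ω) → L²(Ω)`. -/
def fnL : H1 Ω →L[ℝ] L2 Ω :=
  LinearMap.mkContinuous ⟨⟨fn, fun _ _ => rfl⟩, fun _ _ => rfl⟩ 1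
    fun y => (norm_fn_le y).trans_eq (one_mul _).symm

/-- `grad` as a continuous linear map `H¹(Ω) → L²(Ω; ℝ^d)`. -/
def gradL : H1 Ω →L[ℝ] L2Vec Ω :=
  LinearMap.mkContinuous ⟨⟨grad, fun _ _ => rfl⟩, fun _ _ => rfl⟩ 1
    fun y => (norm_grad_le y).trans_eq (one_mul _).symm

lemma fn_add (y z : H1 Ω) : fn (y + z) = fn y + fn z := rfl

lemma fn_sub (y z : H1 Ω) : fn (y - z) = fn y - fn z := rfl

lemma grad_sub (y z : H1 Ω) : grad (y - z) = grad y - grad z := rfl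

namespace IsTest

variable {φ ψ : E d → ℝ}

lemma mono {A B : Set (E d)} (h : IsTest A φ) (hAB : A ⊆ B) : IsTest B φ :=
  ⟨h.contDiff, h.hasCompactSupport, h.tsupport_subset.trans hAB⟩

lemma to_univ (h : IsTest Ω φ) : IsTest univ φ := ⟨h.contDiff, h.hasCompactSupport, subset_univ _⟩

lemma continuous (h : IsTest Ω φ) : Continuous φ := h.contDiff.continuous

lemma contDiff_one (h : IsTest Ω φ) : ContDiff ℝ 1 φ := h.contDiff.of_le (by simp)

lemma differentiable (h : IsTest Ω φ) : Differentiable ℝ φ := h.contDiff.differentiable (by simp)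

lemma continuous_fderiv_apply (h : IsTest Ω φ) (v : E d) : Continuous fun x => fderiv ℝ φ x v :=
  (h.contDiff.continuous_fderiv (by simp)).clm_apply continuous_const

lemma continuous_gradient (h : IsTest Ω φ) : Continuous (gradient φ) :=
  (InnerProductSpace.toDual ℝ (E d)).symm.continuous.comp (h.contDiff.continuous_fderiv (by simp))

lemma hasCompactSupport_gradient (h : IsTest Ω φ) : HasCompactSupport (gradient φ) :=
  (h.hasCompactSupport.fderiv ℝ).comp_left (map_zero (InnerProductSpace.toDual ℝ (E d)).symm)

lemma eq_zero_of_notMem (h : IsTest Ω φ) {x : E d} (hx : x ∉ Ω) : φ x = 0 :=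
  image_eq_zero_of_notMem_tsupport fun hφ => hx (h.tsupport_subset hφ)

lemma fderiv_eq_zero_of_notMem (h : IsTest Ω φ) {x : E d} (hx : x ∉ Ω) : fderiv ℝ φ x = 0 :=
  image_eq_zero_of_notMem_tsupport fun hφ => hx (h.tsupport_subset (tsupport_fderiv_subset ℝ hφ))

lemma mul_left (h : IsTest Ω φ) (hψ : ContDiff ℝ ∞ ψ) : IsTest Ω fun x => ψ x * φ x where
  contDiff := hψ.mul h.contDiff
  hasCompactSupport := h.hasCompactSupport.mul_left
  tsupport_subset := (tsupport_mul_subset_right (f := ψ)).trans h.tsupport_subset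

lemma mul_right (h : IsTest Ω φ) (hψ : ContDiff ℝ ∞ ψ) : IsTest Ω fun x => φ x * ψ x where
  contDiff := h.contDiff.mul hψ
  hasCompactSupport := h.hasCompactSupport.mul_right
  tsupport_subset := (tsupport_mul_subset_left (g := ψ)).trans h.tsupport_subset

lemma sub (h : IsTest Ω φ) (hψ : IsTest Ω ψ) : IsTest Ω fun x => φ x - ψ x where
  contDiff := h.contDiff.sub hψ.contDiff
  hasCompactSupport := h.hasCompactSupport.sub hψ.hasCompactSupport
  tsupport_subset := (tsupport_sub φ ψ).trans (union_subset h.tsupport_subset hψ.tsupport_subset)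

lemma exists_eLpNorm_mul_le (h : IsTest Ω φ) {p : ℝ≥0∞}
    (μ : Measure (E d)) :
    ∃ C : ℝ≥0, ∀ f : E d → ℝ, eLpNorm (fun x => φ x * f x) p μ ≤ C * eLpNorm f p μ := by
  obtain ⟨C, hC⟩ := h.continuous.bounded_above_of_compact_support h.hasCompactSupport
  refine ⟨C.toNNReal, fun f => eLpNorm_le_nnreal_smul_eLpNorm_of_ae_le_mul
    (Eventually.of_forall fun x => ?_) p⟩
  rw [nnnorm_mul]
  gcongr
  exact NNReal.le_toNNReal_of_coe_le (hC x)

section Integrability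

variable {μ : Measure (E d)} [IsFiniteMeasureOnCompacts μ] {p : ℝ≥0∞}

lemma memLp (h : IsTest Ω φ) : MemLp φ p μ :=
  h.continuous.memLp_of_hasCompactSupport h.hasCompactSupport

lemma memLp_smul_const (h : IsTest Ω φ) (v : E d) : MemLp (fun x => φ x • v) p μ :=
  (h.continuous.smul continuous_const).memLp_of_hasCompactSupport h.hasCompactSupport.smul_right

lemma memLp_fderiv_apply (h : IsTest Ω φ) (v : E d) : MemLp (fun x => fderiv ℝ φ x v) p μ :=
  (h.continuous_fderiv_apply v).memLp_of_hasCompactSupport (h.hasCompactSupport.fderiv_apply ℝ v)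

lemma memLp_gradient (h : IsTest Ω φ) : MemLp (gradient φ) p μ :=
  h.continuous_gradient.memLp_of_hasCompactSupport h.hasCompactSupport_gradient

end Integrability

lemma integral_fderiv_apply_eq_zero (h : IsTest Ω φ) (v : E d) :
    ∫ x in Ω, fderiv ℝ φ x v = 0 := by
  rw [setIntegral_eq_integral_of_forall_compl_eq_zero fun x hx => by
    rw [h.fderiv_eq_zero_of_notMem hx, zero_apply]]
  exact Conductivity.integral_fderiv_apply_eq_zero h.contDiff_one h.hasCompactSupport v

end IsTest

/-- The defect `∫_Ω (y ∂_vψ + (G · v) ψ)` of the integration by parts formula for `y` with candidate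
weak gradient `G`, tested against `ψ` in the direction `v`. -/
def weakDefect (ψ : E d → ℝ) (v : E d) (y : L2 Ω) (G : L2Vec Ω) : ℝ :=
  ∫ x in Ω, (y x * fderiv ℝ ψ x v + inner ℝ (G x) v * ψ x)

lemma weakDefect_eq_inner {ψ : E d → ℝ} (h : IsTest univ ψ) (v : E d) (y : L2 Ω) (G : L2Vec Ω) :
    weakDefect ψ v y G =
      inner ℝ (h.memLp_fderiv_apply v).toLp y + inner ℝ (h.memLp_smul_const v).toLp G := by
  rw [L2.inner_def, L2.inner_def,
    ← integral_add (L2.integrable_inner (𝕜 := ℝ) _ _) (L2.integrable_inner (𝕜 := ℝ) _ _)]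
  refine integral_congr_ae ?_
  filter_upwards [(h.memLp_fderiv_apply v (μ := volume.restrict Ω) (p := 2)).coeFn_toLp,
    (h.memLp_smul_const v (μ := volume.restrict Ω) (p := 2)).coeFn_toLp] with x hx hx'
  rw [hx, hx', real_inner_smul_left, real_inner_comm, mul_comm (inner ℝ _ _)]
  rfl

lemma continuous_weakDefect {ψ : E d → ℝ} (h : IsTest univ ψ) (v : E d) :
    Continuous fun w : WithLp 2 (L2 Ω × L2Vec Ω) => weakDefect ψ v w.fst w.snd := by
  simp_rw [weakDefect_eq_inner h]
  fun_prop

lemma weakDefect_eq_add {ψ : E d → ℝ} (h : IsTest univ ψ) (v : E d) (y : L2 Ω) (G : L2Vec Ω) :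
    weakDefect ψ v y G = (∫ x in Ω, y x * fderiv ℝ ψ x v) + ∫ x in Ω, inner ℝ (G x) v * ψ x :=
  integral_add ((Lp.memLp y).integrable_mul (h.memLp_fderiv_apply v (p := 2)))
    (((Lp.memLp G).inner_const v).integrable_mul (h.memLp (p := 2)))

lemma isWeakGradient_iff_weakDefect_eq_zero {y : L2 Ω} {G : L2Vec Ω} :
    IsWeakGradient y G ↔ ∀ φ, IsTest Ω φ → ∀ v, weakDefect φ v y G = 0 := by
  refine forall₃_congr fun φ hφ v => ?_
  rw [weakDefect_eq_add hφ.to_univ, add_eq_zero_iff_eq_neg]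

lemma isClosed_H1 : IsClosed (H1 Ω : Set (WithLp 2 (L2 Ω × L2Vec Ω))) := by
  have : (H1 Ω : Set (WithLp 2 (L2 Ω × L2Vec Ω))) =
      ⋂ (φ : E d → ℝ) (_ : IsTest Ω φ) (v : E d), {w | weakDefect φ v w.fst w.snd = 0} := by
    ext w
    simp only [mem_iInter, mem_ofPred_eq]
    exact isWeakGradient_iff_weakDefect_eq_zero
  rw [this]
  exact isClosed_iInter fun φ => isClosed_iInter fun h => isClosed_iInter fun v =>
    isClosed_singleton.preimage (continuous_weakDefect h.to_univ v)

instance : CompleteSpace (H1 Ω) := isClosed_H1.completeSpace_coe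

instance : CompleteSpace (H10 Ω) :=
  (Submodule.isClosed_topologicalClosure (testH1 Ω)).completeSpace_coe

lemma weakDefect_toLp {φ ψ : E d → ℝ} (h : IsTest univ φ) (hψ : IsTest univ ψ) (v : E d) :
    weakDefect (Ω := Ω) ψ v h.memLp.toLp h.memLp_gradient.toLp =
      ∫ x in Ω, fderiv ℝ (fun z => φ z * ψ z) x v := by
  refine integral_congr_ae ?_
  filter_upwards [(h.memLp (μ := volume.restrict Ω) (p := 2)).coeFn_toLp,
    (h.memLp_gradient (μ := volume.restrict Ω) (p := 2)).coeFn_toLp] with x hx hx'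
  rw [hx, hx', inner_gradient, fderiv_fun_mul_apply (h.differentiable x) (hψ.differentiable x)]

/-- The class in `H¹(Ω)` of a smooth compactly supported function on `ℝ^d`. -/
def IsTest.toH1 {φ : E d → ℝ} (h : IsTest univ φ) (Ω : Set (E d)) : H1 Ω :=
  ⟨WithLp.toLp 2 (h.memLp.toLp, h.memLp_gradient.toLp),
    isWeakGradient_iff_weakDefect_eq_zero.2 fun _ hψ v => (weakDefect_toLp h hψ.to_univ v).trans
      ((hψ.mul_left h.contDiff).integral_fderiv_apply_eq_zero v)⟩

section

variable {φ ψ : E d → ℝ}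

lemma IsTest.fn_toH1 (h : IsTest univ φ) : fn (h.toH1 Ω) =ᵐ[volume.restrict Ω] φ :=
  h.memLp.coeFn_toLp

lemma IsTest.grad_toH1 (h : IsTest univ φ) : grad (h.toH1 Ω) =ᵐ[volume.restrict Ω] gradient φ :=
  h.memLp_gradient.coeFn_toLp

lemma IsTest.weakDefect_toH1 (h : IsTest univ φ) (hψ : IsTest univ ψ) (v : E d) :
    weakDefect ψ v (fn (h.toH1 Ω)) (grad (h.toH1 Ω)) =
      ∫ x in Ω, fderiv ℝ (fun z => φ z * ψ z) x v :=
  weakDefect_toLp h hψ v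

end

lemma grad_eq_zero_of_fn_eq_zero (hΩ : IsOpen Ω) {w : H1 Ω} (hw : fn w = 0) : grad w = 0 := by
  have hloc : LocallyIntegrableOn (grad w) Ω volume :=
    locallyIntegrableOn_of_locallyIntegrable_restrict
      ((Lp.memLp (grad w)).locallyIntegrable one_le_two)
  refine Lp.eq_zero_iff_ae_eq_zero.2 ((ae_restrict_iff' hΩ.measurableSet).2 ?_)
  refine hΩ.ae_eq_zero_of_integral_contDiff_smul_eq_zero hloc fun ψ h₁ h₂ h₃ => ?_
  have hψ : IsTest Ω ψ := ⟨h₁, h₂, h₃⟩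
  rw [← setIntegral_eq_integral_of_forall_compl_eq_zero (s := Ω) fun x hx => by
    rw [hψ.eq_zero_of_notMem hx, zero_smul]]
  have hint : Integrable (fun x => ψ x • grad w x) (volume.restrict Ω) :=
    memLp_one_iff_integrable.1 ((Lp.memLp (grad w)).smul (hψ.memLp (p := 2)))
  refine ext_inner_left ℝ fun v => ?_
  rw [inner_zero_right, ← integral_inner hint]
  calc ∫ x in Ω, inner ℝ v (ψ x • grad w x) = weakDefect ψ v (fn w) (grad w) := by
        refine integral_congr_ae ?_
        filter_upwards [Lp.coeFn_zero ℝ 2 (volume.restrict Ω)] with x hx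
        rw [hw, hx, Pi.zero_apply, zero_mul, zero_add, real_inner_smul_right, real_inner_comm,
          mul_comm]
    _ = 0 := isWeakGradient_iff_weakDefect_eq_zero.1 w.2 ψ hψ v

lemma fn_injective (hΩ : IsOpen Ω) : Function.Injective (fn : H1 Ω → L2 Ω) := by
  refine (injective_iff_map_eq_zero fnL).2 fun w (hw : fn w = 0) => ?_
  rw [← norm_eq_zero, ← sq_eq_zero_iff, norm_sq_eq, hw, grad_eq_zero_of_fn_eq_zero hΩ hw]
  simp

lemma eq_toH1 (hΩ : IsOpen Ω) {φ : E d → ℝ} (h : IsTest univ φ) {w : H1 Ω}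
    (hw : fn w =ᵐ[volume.restrict Ω] φ) : w = h.toH1 Ω :=
  fn_injective hΩ (Lp.ext (hw.trans h.fn_toH1.symm))

lemma memLp_mul_fn {χ : E d → ℝ} (h : IsTest univ χ) (y : L2 Ω) :
    MemLp (fun x => χ x * y x) 2 (volume.restrict Ω) :=
  (Lp.memLp y).smul (h.memLp (p := ∞))

lemma memLp_mul_grad {χ : E d → ℝ} (h : IsTest univ χ) (y : L2 Ω) (G : L2Vec Ω) :
    MemLp (fun x => χ x • G x + y x • gradient χ x) 2 (volume.restrict Ω) :=
  ((Lp.memLp G).smul (h.memLp (p := ∞))).add ((h.memLp_gradient (p := ∞)).smul (Lp.memLp y))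

lemma weakDefect_toLp_mul {χ ψ : E d → ℝ} (h : IsTest univ χ) (hψ : IsTest univ ψ) (v : E d)
    (y : L2 Ω) (G : L2Vec Ω) :
    weakDefect ψ v (memLp_mul_fn h y).toLp (memLp_mul_grad h y G).toLp =
      weakDefect (fun x => χ x * ψ x) v y G := by
  refine integral_congr_ae ?_
  filter_upwards [(memLp_mul_fn h y).coeFn_toLp, (memLp_mul_grad h y G).coeFn_toLp] with x hx hx'
  rw [hx, hx', fderiv_fun_mul_apply (h.differentiable x) (hψ.differentiable x), inner_add_left,
    real_inner_smul_left, real_inner_smul_left, inner_gradient]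
  ring

/-- The product `χ y` of `y ∈ H¹(Ω)` with a smooth compactly supported function `χ`, with weak
gradient `χ ∇y + y ∇χ`. -/
def IsTest.mulH1 {χ : E d → ℝ} (h : IsTest univ χ) (y : H1 Ω) : H1 Ω :=
  ⟨WithLp.toLp 2 ((memLp_mul_fn h (fn y)).toLp, (memLp_mul_grad h (fn y) (grad y)).toLp),
    isWeakGradient_iff_weakDefect_eq_zero.2 fun _ hφ v =>
      (weakDefect_toLp_mul h hφ.to_univ v (fn y) (grad y)).trans
        (isWeakGradient_iff_weakDefect_eq_zero.1 y.2 _ (hφ.mul_left h.contDiff) v)⟩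

lemma IsTest.fn_mulH1 {χ : E d → ℝ} (h : IsTest univ χ) (y : H1 Ω) :
    fn (h.mulH1 y) =ᵐ[volume.restrict Ω] fun x => χ x * fn y x :=
  (memLp_mul_fn h (fn y)).coeFn_toLp

lemma IsTest.weakDefect_mulH1 {χ ψ : E d → ℝ} (h : IsTest univ χ) (hψ : IsTest univ ψ) (v : E d)
    (y : H1 Ω) : weakDefect ψ v (fn (h.mulH1 y)) (grad (h.mulH1 y)) =
      weakDefect (fun x => χ x * ψ x) v (fn y) (grad y) :=
  weakDefect_toLp_mul h hψ v (fn y) (grad y)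

lemma IsTest.norm_fn_toH1_le (hd : 1 ≤ d) {R : ℝ} (hR₀ : 0 ≤ R)
    (hR : ∀ x ∈ Ω, ‖x‖ ≤ R) {φ : E d → ℝ} (h : IsTest Ω φ) :
    ‖fn (h.to_univ.toH1 Ω)‖ ≤ 2 * R * ‖grad (h.to_univ.toH1 Ω)‖ := by
  have : Nonempty (Fin d) := ⟨⟨0, hd⟩⟩
  refine (sq_le_sq₀ (norm_nonneg _) (by positivity)).1 ?_
  rw [mul_pow, norm_sq_eq_integral_of_ae_eq h.to_univ.fn_toH1,
    norm_sq_eq_integral_of_ae_eq h.to_univ.grad_toH1,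
    setIntegral_eq_integral_of_forall_compl_eq_zero fun x hx => by
      rw [h.eq_zero_of_notMem hx, norm_zero, zero_pow two_ne_zero],
    setIntegral_eq_integral_of_forall_compl_eq_zero fun x hx => by
      rw [gradient, h.fderiv_eq_zero_of_notMem hx, map_zero, norm_zero, zero_pow two_ne_zero]]
  simpa [gradient] using integral_sq_le_mul_integral_norm_fderiv_sq h.contDiff_one
    h.hasCompactSupport fun x hx => hR x (h.tsupport_subset hx)

lemma exists_norm_le_mul_norm_grad (hd : 1 ≤ d) (hΩ : IsOpen Ω) (hb : Bornology.IsBounded Ω) :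
    ∃ C : ℝ, 0 < C ∧ ∀ w ∈ H10 Ω, ‖w‖ ≤ C * ‖grad w‖ := by
  obtain ⟨R, hR₀, hR⟩ := hb.exists_pos_norm_le
  refine ⟨2 * R + 1, by positivity, fun w hw => ?_⟩
  have hfn : ‖fn w‖ ≤ 2 * R * ‖grad w‖ := by
    have hcl : IsClosed {w : H1 Ω | ‖fn w‖ ≤ 2 * R * ‖grad w‖} :=
      isClosed_le fnL.continuous.norm (continuous_const.mul gradL.continuous.norm)
    refine closure_minimal ?_ hcl hw
    rintro w ⟨φ, hφ, hw⟩
    rw [mem_ofPred_eq, eq_toH1 hΩ hφ.to_univ hw]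
    exact hφ.norm_fn_toH1_le hd hR₀.le hR
  refine (sq_le_sq₀ (norm_nonneg _) (by positivity)).1 ?_
  rw [norm_sq_eq]
  nlinarith [norm_nonneg (fn w), norm_nonneg (grad w), mul_nonneg hR₀.le (sq_nonneg ‖grad w‖)]

section Multiplication

/-- Multiplication of square integrable vector fields by `u ∈ L^∞(Ω)`. -/
def mulL (u : LInf Ω) : L2Vec Ω →L[ℝ] L2Vec Ω :=
  (ContinuousLinearMap.lsmul ℝ ℝ : ℝ →L[ℝ] E d →L[ℝ] E d).holderL (volume.restrict Ω) ∞ 2 2 u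

lemma mulL_apply_ae (u : LInf Ω) (X : L2Vec Ω) :
    mulL u X =ᵐ[volume.restrict Ω] fun x => u x • X x :=
  ContinuousLinearMap.coeFn_holder (r := 2) (ContinuousLinearMap.lsmul ℝ ℝ) u X

lemma mulL_sub (u₁ u₂ : LInf Ω) : mulL (u₁ - u₂) = mulL u₁ - mulL u₂ := map_sub _ _ _

lemma inner_mulL (u : LInf Ω) (X Y : L2Vec Ω) :
    inner ℝ (mulL u X) Y = ∫ x in Ω, u x * inner ℝ (X x) (Y x) := by
  rw [L2.inner_def]
  refine integral_congr_ae ?_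
  filter_upwards [mulL_apply_ae u X] with x hx
  rw [hx, real_inner_smul_left]

lemma norm_mulL_le (u : LInf Ω) (X : L2Vec Ω) : ‖mulL u X‖ ≤ ‖u‖ * ‖X‖ :=
  (ContinuousLinearMap.norm_holder_apply_apply_le (r := 2)
    (ContinuousLinearMap.lsmul ℝ ℝ : ℝ →L[ℝ] E d →L[ℝ] E d) u X).trans <| by
      rw [mul_assoc]
      exact mul_le_of_le_one_left (by positivity) ContinuousLinearMap.opNorm_lsmul_le

lemma norm_mulL_le_of_ae_norm_le {u : LInf Ω} {M : ℝ}
    (hu : ∀ᵐ x ∂(volume.restrict Ω), ‖u x‖ ≤ M) (X : L2Vec Ω) : ‖mulL u X‖ ≤ M * ‖X‖ := by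
  refine Lp.norm_le_mul_norm_of_ae_le_mul ?_
  filter_upwards [mulL_apply_ae u X, hu] with x hx hux
  rw [hx, norm_smul]
  gcongr

lemma le_inner_mulL_of_ae_le {u : LInf Ω} {m : ℝ} (hu : ∀ᵐ x ∂(volume.restrict Ω), m ≤ u x)
    (X : L2Vec Ω) : m * ‖X‖ ^ 2 ≤ inner ℝ (mulL u X) X := by
  rw [← real_inner_self_eq_norm_sq, L2.inner_def, ← integral_const_mul, L2.inner_def]
  refine integral_mono_ae ((L2.integrable_inner (𝕜 := ℝ) X X).const_mul m)
    (L2.integrable_inner (𝕜 := ℝ) _ _) ?_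
  filter_upwards [hu, mulL_apply_ae u X] with x hux hx
  rw [hx, real_inner_smul_left]
  exact mul_le_mul_of_nonneg_right hux real_inner_self_nonneg

end Multiplication

section Trace

variable {y z w : H1 Ω} {g : L2Bdry Ω}

lemma HasTrace.exists_tendsto_sub (hΩ : IsOpen Ω) (hy : HasTrace y g) (hz : HasTrace z g) :
    ∃ (φ : ℕ → E d → ℝ) (hφ : ∀ n, IsTest univ (φ n)),
      Tendsto (fun n => (hφ n).toH1 Ω) atTop (𝓝 (y - z)) ∧
        Tendsto (fun n => eLpNorm (φ n) 2 (surface Ω)) atTop (𝓝 0) := by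
  obtain ⟨φ, w, hφ, hw, hwy, hφg⟩ := hy
  obtain ⟨ψ, t, hψ, ht, htz, hψg⟩ := hz
  have hφ' : ∀ n, IsTest univ (φ n) := fun n => ⟨(hφ n).1, (hφ n).2, subset_univ _⟩
  have hψ' : ∀ n, IsTest univ (ψ n) := fun n => ⟨(hψ n).1, (hψ n).2, subset_univ _⟩
  refine ⟨_, fun n => (hφ' n).sub (hψ' n), ?_, ?_⟩
  · refine (hwy.sub htz).congr fun n => eq_toH1 hΩ _ ?_
    filter_upwards [Lp.coeFn_sub (fn (w n)) (fn (t n)), hw n, ht n] with x hx hwx htx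
    rw [fn_sub, hx, Pi.sub_apply, hwx, htx]
  · refine tendsto_of_tendsto_of_tendsto_of_le_of_le tendsto_const_nhds
      (by simpa using hφg.add hψg) (fun _ => zero_le) fun n => ?_
    have e : (fun x => φ n x - ψ n x) = (fun x => φ n x - g x) - fun x => ψ n x - g x := by
      ext x
      simp only [Pi.sub_apply, sub_sub_sub_cancel_right]
    rw [e]
    exact eLpNorm_sub_le
      ((hφ' n).continuous.aestronglyMeasurable.sub (Lp.aestronglyMeasurable g))
      ((hψ' n).continuous.aestronglyMeasurable.sub (Lp.aestronglyMeasurable g)) one_le_two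

lemma HasTrace.add_mem_H10 (hΩ : IsOpen Ω) (hy : HasTrace y g) (hw : w ∈ H10 Ω) :
    HasTrace (y + w) g := by
  obtain ⟨φ, s, hφ, hs, hsy, hφg⟩ := hy
  obtain ⟨t, ht, htw⟩ := mem_closure_iff_seq_limit.1 hw
  choose ψ hψ htψ using ht
  refine ⟨fun n x => φ n x + ψ n x, fun n => s n + t n, fun n => ?_, fun n => ?_,
    hsy.add htw, hφg.congr fun n => eLpNorm_congr_ae ?_⟩
  · exact ⟨(hφ n).1.add (hψ n).contDiff, (hφ n).2.add (hψ n).hasCompactSupport⟩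
  · filter_upwards [Lp.coeFn_add (fn (s n)) (fn (t n)), hs n, htψ n] with x hx hsx htx
    rw [fn_add, hx, Pi.add_apply, hsx, htx]
  · filter_upwards [ae_restrict_mem isClosed_frontier.measurableSet] with x hx
    have hxΩ := (disjoint_frontier_iff_isOpen.2 hΩ).notMem_of_mem_left hx
    rw [(hψ n).eq_zero_of_notMem hxΩ, add_zero]

end Trace

section ZeroExtension

open scoped Convolution Pointwise
open ContinuousLinearMap (lsmul)

/-- An element of `H¹(Ω)` whose extension by zero has the extension by zero of its gradient as weak
gradient on the whole space. -/
def HasZeroExtension (y : H1 Ω) : Prop :=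
  ∀ ψ : E d → ℝ, IsTest univ ψ → ∀ v, weakDefect ψ v (fn y) (grad y) = 0

lemma HasZeroExtension.mulH1 {y : H1 Ω} (hy : HasZeroExtension y) {χ : E d → ℝ}
    (h : IsTest univ χ) : HasZeroExtension (h.mulH1 y) := fun ψ hψ v => by
  rw [h.weakDefect_mulH1 hψ]
  exact hy _ (hψ.mul_left h.contDiff) v

lemma memLp_indicator {F : Type*} [NormedAddCommGroup F] (hΩ : MeasurableSet Ω)
    (f : Lp F 2 (volume.restrict Ω)) : MemLp (Ω.indicator f) 2 volume :=
  (memLp_indicator_iff_restrict hΩ).2 (Lp.memLp f)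

lemma locallyIntegrable_indicator {F : Type*} [NormedAddCommGroup F] (hΩ : MeasurableSet Ω)
    (f : Lp F 2 (volume.restrict Ω)) : LocallyIntegrable (Ω.indicator f) volume :=
  (memLp_indicator hΩ f).locallyIntegrable one_le_two

lemma IsTest.comp_sub_left {η : E d → ℝ} (hη : IsTest univ η) (x : E d) :
    IsTest univ fun z => η (x - z) :=
  ⟨hη.contDiff.comp (contDiff_const.sub contDiff_id),
    hη.hasCompactSupport.comp_homeomorph (Homeomorph.subLeft x), subset_univ _⟩

lemma HasZeroExtension.gradient_convolution (hΩ : MeasurableSet Ω) {y : H1 Ω}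
    (hy : HasZeroExtension y) {η : E d → ℝ} (hη : IsTest univ η) :
    gradient (η ⋆[lsmul ℝ ℝ] Ω.indicator (fn y)) = η ⋆[lsmul ℝ ℝ] Ω.indicator (grad y) := by
  refine funext fun x => ext_inner_right ℝ fun v => ?_
  have hint : Integrable (fun z => η (x - z) • Ω.indicator (grad y) z) :=
    ((hη.hasCompactSupport.convolutionExists_left (lsmul ℝ ℝ) hη.continuous
      (locallyIntegrable_indicator hΩ (grad y))) x).integrable_swap
  have hdefect := hy _ (hη.comp_sub_left x) v
  have hderiv (z : E d) : fderiv ℝ (fun z => η (x - z)) z v = -fderiv ℝ η (x - z) v := by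
    have h : HasFDerivAt (fun z => η (x - z)) _ z :=
      (hη.differentiable (x - z)).hasFDerivAt.comp z ((hasFDerivAt_id z).const_sub x)
    simp [h.fderiv]
  rw [weakDefect_eq_add (hη.comp_sub_left x), add_comm] at hdefect
  calc inner ℝ (gradient (η ⋆[lsmul ℝ ℝ] Ω.indicator (fn y)) x) v
      = ∫ z, fderiv ℝ η (x - z) v • Ω.indicator (fn y) z := by
        rw [inner_gradient, fderiv_convolution_lsmul_apply hη.hasCompactSupport hη.contDiff_one
          (locallyIntegrable_indicator hΩ (fn y)), convolution_eq_swap]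
        rfl
    _ = -∫ z in Ω, fn y z * fderiv ℝ (fun z => η (x - z)) z v := by
        simp_rw [hderiv, ← integral_neg, ← integral_indicator hΩ]
        congr with z
        by_cases hz : z ∈ Ω <;> simp [hz, mul_comm]
    _ = ∫ z in Ω, inner ℝ (grad y z) v * η (x - z) := (eq_neg_of_add_eq_zero_left hdefect).symm
    _ = ∫ z, inner ℝ v (η (x - z) • Ω.indicator (grad y) z) := by
        rw [← integral_indicator hΩ]
        congr with z
        by_cases hz : z ∈ Ω <;> simp [hz, real_inner_smul_right, real_inner_comm, mul_comm]
    _ = inner ℝ ((η ⋆[lsmul ℝ ℝ] Ω.indicator (grad y)) x) v := by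
        rw [integral_inner hint, real_inner_comm, convolution_eq_swap]
        rfl

lemma IsTest.convolution {η : E d → ℝ} (hη : IsTest univ η) {f : E d → ℝ}
    (hf : LocallyIntegrable f) {K : Set (E d)} (hK : IsCompact K)
    (hfK : ∀ᵐ x, x ∉ K → f x = 0) (hΩ : tsupport η + K ⊆ Ω) :
    IsTest Ω (η ⋆[lsmul ℝ ℝ] f) := by
  have hcompact : IsCompact (tsupport η + K) := hη.hasCompactSupport.isCompact.add hK
  have hfK' : f =ᵐ[volume] K.indicator f := hfK.mono fun x hx => by
    by_cases hxK : x ∈ K <;> simp [hxK, hx]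
  have hsupp : tsupport (η ⋆[lsmul ℝ ℝ] f) ⊆ tsupport η + K := by
    refine closure_minimal ?_ hcompact.isClosed
    rw [convolution_congr (lsmul ℝ ℝ) EventuallyEq.rfl hfK']
    exact (support_convolution_subset _).trans
      (add_subset_add (subset_tsupport η) support_indicator_subset)
  exact ⟨hη.hasCompactSupport.contDiff_convolution_left _ hη.contDiff hf,
    hcompact.of_isClosed_subset (isClosed_tsupport _) hsupp, hsupp.trans hΩ⟩

lemma norm_sub_le_of_ae_eq_normed_convolution {F : Type*} [NormedAddCommGroup F] [NormedSpace ℝ F]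
    [CompleteSpace F] (hΩ : MeasurableSet Ω) {f g : Lp F 2 (volume.restrict Ω)} {c : E d}
    (b : ContDiffBump c)
    (hg : g =ᵐ[volume.restrict Ω] b.normed volume ⋆[lsmul ℝ ℝ] Ω.indicator f) {ε : ℝ} (hε : 0 ≤ ε)
    (h : ∀ s ∈ Metric.ball c b.rOut,
      eLpNorm (fun x => Ω.indicator f (x - s) - Ω.indicator f x) 2 volume ≤ ENNReal.ofReal ε) :
    ‖g - f‖ ≤ ε := by
  rw [Lp.norm_def]
  refine ENNReal.toReal_le_of_le_ofReal hε (le_trans ?_ (eLpNorm_normed_convolution_sub_le b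
    one_le_two (memLp_indicator hΩ f) ((Lp.stronglyMeasurable f).indicator hΩ) h))
  refine (eLpNorm_congr_ae ?_).trans_le (eLpNorm_mono_measure _ Measure.restrict_le_self)
  filter_upwards [Lp.coeFn_sub g f, hg, ae_restrict_mem hΩ] with x hsub hφ hx
  rw [hsub, Pi.sub_apply, hφ, indicator_of_mem hx]

lemma norm_le_norm_fn_add_norm_grad (y : H1 Ω) : ‖y‖ ≤ ‖fn y‖ + ‖grad y‖ := by
  refine abs_le_of_sq_le_sq' ?_ (by positivity) |>.2
  rw [norm_sq_eq, add_sq]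
  have : 0 ≤ 2 * ‖fn y‖ * ‖grad y‖ := by positivity
  linarith

/- Mollifying with a kernel supported in a small ball inside `N` pushes the support of `y` into
`Ω`, while moving the extensions by zero of `y` and `∇y` only slightly in `L²`. -/
lemma HasZeroExtension.mem_H10_of_add_mem (hΩ : IsOpen Ω) {y : H1 Ω} (hy : HasZeroExtension y)
    {K N : Set (E d)} (hK : IsCompact K) (hyK : ∀ᵐ x ∂volume.restrict Ω, x ∉ K → fn y x = 0)
    (hN : IsOpen N) (hN₀ : 0 ∈ closure N) (hKN : ∀ z ∈ K, ∀ s ∈ N, z + s ∈ Ω) : y ∈ H10 Ω := by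
  have hΩm := hΩ.measurableSet
  refine Metric.mem_closure_iff.2 fun ε hε => ?_
  have hε' : 0 < ENNReal.ofReal (ε / 3) := ENNReal.ofReal_pos.2 (by positivity)
  obtain ⟨c, r, hr, hball⟩ := exists_closedBall_of_mem_closure hN hN₀
    (((tendsto_eLpNorm_translate_sub ENNReal.ofNat_ne_top
      (memLp_indicator hΩm (fn y))).eventually_le_const hε').and
    ((tendsto_eLpNorm_translate_sub ENNReal.ofNat_ne_top
      (memLp_indicator hΩm (grad y))).eventually_le_const hε'))
  let b : ContDiffBump c := ⟨r / 2, r, by positivity, by linarith⟩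
  have hb : IsTest univ (b.normed volume) :=
    ⟨b.contDiff_normed, b.hasCompactSupport_normed, subset_univ _⟩
  have hφ : IsTest Ω (b.normed volume ⋆[lsmul ℝ ℝ] Ω.indicator (fn y)) := by
    refine hb.convolution (locallyIntegrable_indicator hΩm (fn y)) hK ?_ ?_
    · filter_upwards [(ae_restrict_iff' hΩm).1 hyK] with x hx hxK
      by_cases hxΩ : x ∈ Ω <;> simp [hxΩ, hx, hxK]
    · rw [b.tsupport_normed_eq, add_comm]
      exact add_subset_iff.2 fun z hz s hs => hKN z hz s (hball s hs).1
  have hfn : ‖fn (hφ.to_univ.toH1 Ω) - fn y‖ ≤ ε / 3 :=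
    norm_sub_le_of_ae_eq_normed_convolution hΩm b hφ.to_univ.fn_toH1 (by positivity)
      fun s hs => (hball s (Metric.ball_subset_closedBall hs)).2.1
  have hgrad : ‖grad (hφ.to_univ.toH1 Ω) - grad y‖ ≤ ε / 3 :=
    norm_sub_le_of_ae_eq_normed_convolution hΩm b
      (hy.gradient_convolution hΩm hb ▸ hφ.to_univ.grad_toH1) (by positivity)
      fun s hs => (hball s (Metric.ball_subset_closedBall hs)).2.2
  refine ⟨hφ.to_univ.toH1 Ω, ⟨_, hφ, hφ.to_univ.fn_toH1⟩, ?_⟩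
  rw [dist_comm, dist_eq_norm]
  have := norm_le_norm_fn_add_norm_grad (hφ.to_univ.toH1 Ω - y)
  rw [fn_sub, grad_sub] at this
  linarith

end ZeroExtension

/-- A bounded open set with `C¹` boundary, given near each boundary point by a sublevel set as in
`IsSmoothBoundedOpen`. -/
structure IsC1BoundedOpen (Ω : Set (E d)) : Prop where
  isOpen : IsOpen Ω
  isBounded : Bornology.IsBounded Ω
  c1_boundary : ∀ x ∈ frontier Ω, ∃ (V : Set (E d)) (ρ : E d → ℝ),
    IsOpen V ∧ x ∈ V ∧ ContDiffOn ℝ 1 ρ V ∧ fderiv ℝ ρ x ≠ 0 ∧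
      Ω ∩ V = {z ∈ V | ρ z < 0}

lemma IsSmoothBoundedOpen.isC1BoundedOpen (hΩ : IsSmoothBoundedOpen Ω) : IsC1BoundedOpen Ω where
  isOpen := hΩ.isOpen
  isBounded := hΩ.isBounded
  c1_boundary x hx := by
    obtain ⟨V, ρ, hV, hxV, hρ, hρ', hΩV⟩ := hΩ.smooth_boundary x hx
    exact ⟨V, ρ, hV, hxV, hρ.of_le (by simp), hρ', hΩV⟩

lemma IsC1BoundedOpen.exists_isOpen_forall_add_mem (hΩ : IsC1BoundedOpen Ω) {x₀ : E d}
    (hx₀ : x₀ ∈ closure Ω) :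
    ∃ V ∈ 𝓝 x₀, ∃ N, IsOpen N ∧ 0 ∈ closure N ∧ ∀ z ∈ closure Ω ∩ V, ∀ s ∈ N, z + s ∈ Ω := by
  by_cases hx : x₀ ∈ Ω
  · have hadd : Tendsto (fun p : E d × E d => p.1 + p.2) (𝓝 (x₀, 0)) (𝓝 x₀) := by
      simpa using continuous_add.tendsto (x₀, (0 : E d))
    obtain ⟨V, hV, B, hB, hVB⟩ :=
      mem_nhds_prod_iff.1 (hadd.eventually_mem (hΩ.isOpen.mem_nhds hx))
    exact ⟨V, hV, interior B, isOpen_interior, subset_closure (mem_interior_iff_mem_nhds.2 hB),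
      fun z hz s hs => hVB (mk_mem_prod hz.2 (interior_subset hs))⟩
  · obtain ⟨W, ρ, hW, hxW, hρ, hρ', hΩW⟩ :=
      hΩ.c1_boundary x₀ (hΩ.isOpen.frontier_eq ▸ ⟨hx₀, hx⟩)
    have hW' := hW.mem_nhds hxW
    obtain ⟨V, hV, N, hN, hN₀, hVN⟩ := exists_isOpen_forall_add_lt
      ((hρ.contDiffAt hW').hasStrictFDerivAt one_ne_zero) hρ' hW'
    refine ⟨V ∩ W, inter_mem hV hW', N, hN, hN₀, fun z hz s hs => ?_⟩
    obtain ⟨hmem, hlt⟩ := hVN z hz.2.1 s hs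
    have hρz := nonpos_of_mem_closure hW hρ.continuousOn hΩW hz.1 hz.2.2
    exact (hΩW.superset ⟨hmem, hlt.trans_le hρz⟩).1

lemma HasZeroExtension.exists_mem_H10_ae_eq_mul (hΩ : IsC1BoundedOpen Ω) {y : H1 Ω}
    (hy : HasZeroExtension y) {x₀ : E d} (hx₀ : x₀ ∈ closure Ω) :
    ∃ V ∈ 𝓝 x₀, ∀ χ : E d → ℝ, ContDiff ℝ ∞ χ → HasCompactSupport χ → tsupport χ ⊆ V →
      ∃ w ∈ H10 Ω, ∀ᵐ x ∂volume.restrict Ω, fn w x = χ x * fn y x := by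
  obtain ⟨V, hV, N, hN, hN₀, hVN⟩ := hΩ.exists_isOpen_forall_add_mem hx₀
  refine ⟨V, hV, fun χ hχ hχc hχV => ?_⟩
  have hχ' : IsTest univ χ := ⟨hχ, hχc, subset_univ _⟩
  refine ⟨hχ'.mulH1 y, (hy.mulH1 hχ').mem_H10_of_add_mem hΩ.isOpen
    (hΩ.isBounded.isCompact_closure.inter_right (isClosed_tsupport χ)) ?_ hN hN₀
    fun z hz => hVN z ⟨hz.1, hχV hz.2⟩, hχ'.fn_mulH1 y⟩
  filter_upwards [hχ'.fn_mulH1 y, ae_restrict_mem hΩ.isOpen.measurableSet] with x hx hxΩ hxK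
  rw [hx, image_eq_zero_of_notMem_tsupport fun h => hxK ⟨subset_closure hxΩ, h⟩, zero_mul]

lemma HasZeroExtension.mem_H10 (hΩ : IsC1BoundedOpen Ω) {y : H1 Ω} (hy : HasZeroExtension y) :
    y ∈ H10 Ω := by
  obtain ⟨χ, -, hχ, w, hw, hwχ⟩ := exists_cutoff hΩ.isBounded.isCompact_closure
    (P := fun χ => ∃ w ∈ H10 Ω, ∀ᵐ x ∂volume.restrict Ω, fn w x = χ x * fn y x)
    ⟨0, zero_mem _, by
      filter_upwards [Lp.coeFn_zero ℝ 2 (volume.restrict Ω)] with x (hx : fn (0 : H1 Ω) x = 0)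
      simp [hx]⟩
    (by
      rintro a b ⟨w, hw, hwa⟩ ⟨z, hz, hzb⟩
      refine ⟨w + z, add_mem hw hz, ?_⟩
      filter_upwards [hwa, hzb, Lp.coeFn_add (fn w) (fn z)] with x ha hb hadd
      rw [fn_add, hadd, Pi.add_apply, Pi.add_apply, ha, hb, add_mul])
    fun x hx => hy.exists_mem_H10_ae_eq_mul hΩ hx
  have : w = y := fn_injective hΩ.isOpen <| Lp.ext <| by
    filter_upwards [hwχ, ae_restrict_mem hΩ.isOpen.measurableSet] with x hx hxΩ
    rw [hx, hχ x (subset_closure hxΩ), one_mul]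
  exact this ▸ hw

section Slices

variable {W : Type*} [NormedAddCommGroup W] [NormedSpace ℝ W] {e : E d ≃L[ℝ] ℝ × W}
  {B : Set (E d)} {ρ : E d → ℝ} {F : E d → ℝ}

lemma IsTest.hasCompactSupport_comp_line (hF : IsTest B F) (w : W) :
    HasCompactSupport fun t : ℝ => F (e.symm (t, w)) := by
  refine HasCompactSupport.intro (hF.hasCompactSupport.isCompact.image
    (continuous_fst.comp e.continuous)) fun t ht => by_contra fun hne => ?_
  exact ht ⟨e.symm (t, w), subset_tsupport F hne, by simp⟩

lemma IsTest.contDiff_comp_line (hF : IsTest B F) (w : W) :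
    ContDiff ℝ 1 fun t : ℝ => F (e.symm (t, w)) :=
  hF.contDiff_one.comp (e.symm.contDiff.comp (contDiff_id.prodMk contDiff_const))

lemma IsTest.deriv_comp_line (hF : IsTest B F) (w : W) :
    (deriv fun t => F (e.symm (t, w))) =
      fun t => fderiv ℝ F (e.symm (t, w)) (e.symm (1, 0)) :=
  funext fun _ => (hasDerivAt_comp_line (hF.differentiable _)).deriv

lemma IsTest.deriv_comp_line_eq_zero (hF : IsTest B F) (w : W) :
    ∀ t ∉ {t : ℝ | e.symm (t, w) ∈ B}, deriv (fun t => F (e.symm (t, w))) t = 0 := fun t ht => by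
  simp only [hF.deriv_comp_line, hF.fderiv_eq_zero_of_notMem ht, zero_apply]

/-- The integral of `∂_v F` over the part in `Ω` of the line `t ↦ e⁻¹(t, w)`, which has the
direction `v = e⁻¹(1, 0)`. -/
def sliceIntegral (Ω : Set (E d)) (e : E d ≃L[ℝ] ℝ × W) (F : E d → ℝ) (w : W) : ℝ :=
  ∫ t, Ω.indicator (fun x => fderiv ℝ F x (e.symm (1, 0))) (e.symm (t, w))

lemma IsTest.sliceIntegral_eq (hF : IsTest B F) (w : W) :
    sliceIntegral Ω e F w =
      ∫ t, {t | e.symm (t, w) ∈ Ω}.indicator (deriv fun t => F (e.symm (t, w))) t := by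
  rw [hF.deriv_comp_line]
  rfl

lemma IsTest.support_sliceIntegral_subset (hF : IsTest B F) (hB : Convex ℝ B)
    (hΩB : Ω ∩ B = {z ∈ B | ρ z < 0}) (hρ : ∀ z ∈ B, DifferentiableAt ℝ ρ z) :
    Function.support (sliceIntegral Ω e F) ⊆ (fun x => (e x).2) '' {x ∈ B | ρ x = 0} := by
  intro w hw
  by_contra hwΓ
  refine hw ((hF.sliceIntegral_eq w).trans ?_)
  exact integral_indicator_deriv_eq_zero (h := fun t => ρ (e.symm (t, w)))
    (hF.contDiff_comp_line w) (hF.hasCompactSupport_comp_line w) (hF.deriv_comp_line_eq_zero w)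
    (convex_line_preimage hB w).ordConnected
    (fun t ht => (hasDerivAt_comp_line (hρ _ ht)).continuousAt.continuousWithinAt)
    (fun t ht ht₀ => hwΓ ⟨_, ⟨ht, ht₀⟩, by simp⟩)
    fun t ht => ⟨fun h => (hΩB.subset ⟨h, ht⟩).2, fun h => (hΩB.superset ⟨ht, h⟩).1⟩

lemma IsTest.sliceIntegral_eq_apply (hF : IsTest B F) (hB : Convex ℝ B)
    (hΩB : Ω ∩ B = {z ∈ B | ρ z < 0}) (hρ : ∀ z ∈ B, DifferentiableAt ℝ ρ z)
    (hpos : ∀ z ∈ B, 0 < fderiv ℝ ρ z (e.symm (1, 0))) {x : E d} (hxB : x ∈ B) (hx : ρ x = 0) :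
    sliceIntegral Ω e F (e x).2 = F x := by
  have hex : e.symm ((e x).1, (e x).2) = x := e.symm_apply_apply x
  have hmono := strictMonoOn_comp_line hB hρ hpos (e x).2
  rw [hF.sliceIntegral_eq, integral_indicator_deriv_eq (hF.contDiff_comp_line _)
    (hF.hasCompactSupport_comp_line _) (hF.deriv_comp_line_eq_zero _) (c := (e x).1), hex]
  intro t ht
  have hlt : ρ (e.symm (t, (e x).2)) < 0 ↔ t < (e x).1 := by
    rw [← hmono.lt_iff_lt ht (by simpa [hex] using hxB)]
    simp only [hex, hx]
  rw [← hlt]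
  exact ⟨fun h => (hΩB.subset ⟨h, ht⟩).2, fun h => (hΩB.superset ⟨ht, h⟩).1⟩

end Slices

/-- The integrals over `Ω` of the derivatives in direction `v` of smooth functions with compact
support in `B` are controlled by their boundary values. By the divergence theorem such an integral
is the flux of `F v` through `∂Ω`; only this estimate is needed, and it avoids a normal field. -/
def HasFluxBound (Ω : Set (E d)) (v : E d) (B : Set (E d)) : Prop :=
  ∃ c : ℝ≥0∞, c ≠ ⊤ ∧ ∀ F : E d → ℝ, IsTest B F →
    ‖∫ x in Ω, fderiv ℝ F x v‖ₑ ≤ c * eLpNorm F 2 (surface Ω)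

lemma restrict_frontier_inter_le_surface {k : ℕ} (hk : k + 1 = d) (B : Set (E d)) :
    (Measure.hausdorffMeasure (k : ℝ)).restrict (frontier Ω ∩ B) ≤ surface Ω := by
  rw [surface, show (d : ℝ) - 1 = k by simp [← hk]]
  exact Measure.restrict_mono inter_subset_left le_rfl

lemma exists_eLpNorm_sliceIntegral_le {W : Type*} [NormedAddCommGroup W] [NormedSpace ℝ W]
    [MeasurableSpace W] [BorelSpace W] {k : ℕ} (hk : k + 1 = d) {B : Set (E d)}
    (hB : MeasurableSet B) (hBc : Convex ℝ B) {ρ : E d → ℝ} (hΩB : Ω ∩ B = {z ∈ B | ρ z < 0})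
    (hΓ : frontier Ω ∩ B = {x ∈ B | ρ x = 0}) (hρ : ∀ z ∈ B, DifferentiableAt ℝ ρ z)
    (e : E d ≃L[ℝ] ℝ × W) (hpos : ∀ z ∈ B, 0 < fderiv ℝ ρ z (e.symm (1, 0))) :
    ∃ C : ℝ≥0∞, C ≠ ⊤ ∧ ∀ F : E d → ℝ, IsTest B F →
      eLpNorm (sliceIntegral Ω e F) 2
        ((Measure.hausdorffMeasure (k : ℝ)).restrict ((fun x => (e x).2) '' (frontier Ω ∩ B))) ≤
          C * eLpNorm F 2 (surface Ω) := by
  let π : E d →L[ℝ] W := (ContinuousLinearMap.snd ℝ ℝ W) ∘L (e : E d →L[ℝ] ℝ × W)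
  refine ⟨((‖π‖₊ : ℝ≥0∞) ^ (k : ℝ)) ^ (1 / (2 : ℝ≥0∞)).toReal,
    ENNReal.rpow_ne_top_of_nonneg (by simp)
      (ENNReal.rpow_ne_top_of_nonneg (Nat.cast_nonneg _) ENNReal.coe_ne_top), fun F hF => ?_⟩
  refine (eLpNorm_restrict_image_hausdorffMeasure_le π.lipschitz (Nat.cast_nonneg _)
    (isClosed_frontier.measurableSet.inter hB) two_ne_zero ENNReal.ofNat_ne_top
    fun x hx => ?_).trans
      (mul_le_mul_right (eLpNorm_mono_measure _ (restrict_frontier_inter_le_surface hk B)) _)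
  obtain ⟨hxB, hx₀⟩ := hΓ.subset hx
  exact (congrArg _ (hF.sliceIntegral_eq_apply hBc hΩB hρ hpos hxB hx₀)).le

lemma hasFluxBound_of_equiv {W : Type*} [NormedAddCommGroup W] [NormedSpace ℝ W]
    [FiniteDimensional ℝ W] [MeasurableSpace W] [BorelSpace W] (hW : Module.finrank ℝ W + 1 = d)
    (hΩ : IsOpen Ω) {B : Set (E d)} (hB : IsOpen B) (hBc : Convex ℝ B)
    (hBb : Bornology.IsBounded B) {ρ : E d → ℝ} (hΩB : Ω ∩ B = {z ∈ B | ρ z < 0})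
    (hρ : ∀ z ∈ B, DifferentiableAt ℝ ρ z) (e : E d ≃L[ℝ] ℝ × W)
    (hpos : ∀ z ∈ B, 0 < fderiv ℝ ρ z (e.symm (1, 0))) :
    HasFluxBound Ω (e.symm (1, 0)) B := by
  let μ : Measure W := Measure.hausdorffMeasure (Module.finrank ℝ W)
  let S : Set W := (fun x => (e x).2) '' (frontier Ω ∩ B)
  have hΓ : frontier Ω ∩ B = {x ∈ B | ρ x = 0} := frontier_inter_eq hΩ hB
    (fun z hz => (hρ z hz).continuousAt.continuousWithinAt) hΩB
    fun z hz h => (hpos z hz).ne' (by rw [h, zero_apply])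
  have hS : μ S ≠ ⊤ := (((ContinuousLinearMap.snd ℝ ℝ W) ∘L
    (e : E d →L[ℝ] ℝ × W)).lipschitz.isBounded_image
      (hBb.subset inter_subset_right)).measure_lt_top.ne
  obtain ⟨c, hc⟩ := exists_integral_eq_mul_integral_integral e volume μ
  obtain ⟨C, hC, hslice⟩ :=
    exists_eLpNorm_sliceIntegral_le hW hB.measurableSet hBc hΩB hΓ hρ e hpos
  let D : ℝ≥0∞ := μ S ^ (1 - 1 / (2 : ℝ≥0∞).toReal)
  have hD : D ≠ ⊤ := ENNReal.rpow_ne_top_of_nonneg (by norm_num) hS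
  refine ⟨c * (C * D), by finiteness, fun F hF => ?_⟩
  obtain ⟨hint, hfub⟩ := hc _ ((memLp_one_iff_integrable.1
    (hF.memLp_fderiv_apply (e.symm (1, 0)))).indicator hΩ.measurableSet)
  rw [integral_indicator hΩ.measurableSet] at hfub
  have hsupp : Function.support (sliceIntegral Ω e F) ⊆ S :=
    (hF.support_sliceIntegral_subset hBc hΩB hρ).trans_eq (congrArg _ hΓ.symm)
  calc ‖∫ x in Ω, fderiv ℝ F x (e.symm (1, 0))‖ₑ
      = c * ‖∫ w, sliceIntegral Ω e F w ∂μ‖ₑ := by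
        rw [hfub, enorm_mul]
        simp [sliceIntegral, enorm_eq_nnnorm]
    _ ≤ c * (C * eLpNorm F 2 (surface Ω) * D) := by
        gcongr
        exact (enorm_integral_le_eLpNorm_mul_of_support_subset hint.aestronglyMeasurable
          hsupp one_le_two).trans (mul_le_mul_left (hslice F hF) _)
    _ = c * (C * D) * eLpNorm F 2 (surface Ω) := by ring

section FluxBound

variable {A B : Set (E d)} {v w : E d}

lemma hasFluxBound_self : HasFluxBound Ω v Ω :=
  ⟨0, ENNReal.zero_ne_top, fun F hF => by simp [hF.integral_fderiv_apply_eq_zero v]⟩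

lemma HasFluxBound.mono (hB : HasFluxBound Ω v B) (hAB : A ⊆ B) : HasFluxBound Ω v A :=
  let ⟨c, hc, h⟩ := hB
  ⟨c, hc, fun F hF => h F (hF.mono hAB)⟩

lemma HasFluxBound.sub_smul (hv : HasFluxBound Ω v B) (hw : HasFluxBound Ω w B) (s : ℝ) :
    HasFluxBound Ω (v - s • w) B := by
  obtain ⟨a, ha, hav⟩ := hv
  obtain ⟨b, hb, hbw⟩ := hw
  refine ⟨a + ‖s‖ₑ * b, by finiteness, fun F hF => ?_⟩
  have hint (u : E d) : IntegrableOn (fun x => fderiv ℝ F x u) Ω :=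
    memLp_one_iff_integrable.1 (hF.memLp_fderiv_apply u)
  simp only [map_sub, map_smul, smul_eq_mul]
  rw [integral_sub (hint v) ((hint w).const_mul s), integral_const_mul]
  calc ‖(∫ x in Ω, fderiv ℝ F x v) - s * ∫ x in Ω, fderiv ℝ F x w‖ₑ
      ≤ ‖∫ x in Ω, fderiv ℝ F x v‖ₑ + ‖s‖ₑ * ‖∫ x in Ω, fderiv ℝ F x w‖ₑ :=
        (enorm_sub_le ..).trans_eq (by rw [enorm_mul])
    _ ≤ a * eLpNorm F 2 (surface Ω) + ‖s‖ₑ * (b * eLpNorm F 2 (surface Ω)) := by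
        gcongr
        exacts [hav F hF, hbw F hF]
    _ = (a + ‖s‖ₑ * b) * eLpNorm F 2 (surface Ω) := by ring

lemma exists_hasFluxBound_of_fderiv_eq_one (hΩ : IsOpen Ω) {V : Set (E d)} (hV : IsOpen V)
    {ρ : E d → ℝ} (hρ : ContDiffOn ℝ 1 ρ V) (hΩV : Ω ∩ V = {z ∈ V | ρ z < 0}) {x₀ : E d}
    (hx₀ : x₀ ∈ V) (hv : fderiv ℝ ρ x₀ v = 1) : ∃ B ∈ 𝓝 x₀, HasFluxBound Ω v B := by
  let ℓ := fderiv ℝ ρ x₀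
  let e := ContinuousLinearEquiv.equivOfRightInverse ℓ
    (ContinuousLinearMap.toSpanSingleton ℝ v) fun t => by simp [ℓ, hv]
  have he : e.symm (1, 0) = v := by
    simp [e, ContinuousLinearEquiv.equivOfRightInverse_symm_apply]
  have hfinrank : Module.finrank ℝ ℓ.ker + 1 = d := by
    refine (Module.Dual.finrank_ker_add_one_of_ne_zero (f := (ℓ : E d →ₗ[ℝ] ℝ)) fun h => ?_).trans
      finrank_euclideanSpace_fin
    exact one_ne_zero (hv.symm.trans (LinearMap.congr_fun h v))
  have hcont : ContinuousAt (fun z => fderiv ℝ ρ z v) x₀ :=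
    ((hρ.continuousOn_fderiv_of_isOpen hV le_rfl).continuousAt
      (hV.mem_nhds hx₀)).clm_apply continuousAt_const
  obtain ⟨r, hr, hball⟩ := Metric.eventually_nhds_iff_ball.1
    ((hcont.eventually_const_lt (one_pos.trans_eq hv.symm)).and (hV.mem_nhds hx₀))
  refine ⟨_, Metric.ball_mem_nhds x₀ hr, he ▸ hasFluxBound_of_equiv hfinrank hΩ Metric.isOpen_ball
    (convex_ball x₀ r) Metric.isBounded_ball (ρ := ρ) (ext fun z => ?_)
    (fun z hz => (hρ.differentiableOn one_ne_zero).differentiableAt (hV.mem_nhds (hball z hz).2))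
    e fun z hz => by rw [he]; exact (hball z hz).1⟩
  exact ⟨fun h => ⟨h.2, (hΩV.subset ⟨h.1, (hball z h.2).2⟩).2⟩,
    fun h => ⟨(hΩV.superset ⟨(hball z h.1).2, h.2⟩).1, h.1⟩⟩

lemma IsC1BoundedOpen.exists_hasFluxBound (hΩ : IsC1BoundedOpen Ω) (v : E d) {x : E d}
    (hx : x ∈ closure Ω) : ∃ B ∈ 𝓝 x, HasFluxBound Ω v B := by
  by_cases hxΩ : x ∈ Ω
  · exact ⟨Ω, hΩ.isOpen.mem_nhds hxΩ, hasFluxBound_self⟩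
  obtain ⟨V, ρ, hV, hxV, hρ, hρ', hΩV⟩ := hΩ.c1_boundary x (hΩ.isOpen.frontier_eq ▸ ⟨hx, hxΩ⟩)
  obtain ⟨w, hw⟩ : ∃ w, fderiv ℝ ρ x w = 1 := by
    obtain ⟨w, hw⟩ := DFunLike.ne_iff.1 hρ'
    exact ⟨(fderiv ℝ ρ x w)⁻¹ • w, by rw [map_smul, smul_eq_mul, inv_mul_cancel₀ hw]⟩
  let s := 1 - fderiv ℝ ρ x v
  have hvw : fderiv ℝ ρ x (v + s • w) = 1 := by simp [s, hw]
  obtain ⟨A, hA, hAw⟩ := exists_hasFluxBound_of_fderiv_eq_one hΩ.isOpen hV hρ hΩV hxV hw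
  obtain ⟨B, hB, hBv⟩ := exists_hasFluxBound_of_fderiv_eq_one hΩ.isOpen hV hρ hΩV hxV hvw
  refine ⟨A ∩ B, inter_mem hA hB, ?_⟩
  simpa using (hBv.mono inter_subset_right).sub_smul (hAw.mono inter_subset_left) s

/-- `χ` is smooth and multiplying by it makes the flux bound `HasFluxBound` hold for all test
functions, so that flux bounds can be glued along a partition of unity. -/
def IsFluxCutoff (Ω : Set (E d)) (v : E d) (χ : E d → ℝ) : Prop :=
  ContDiff ℝ ∞ χ ∧ ∃ c : ℝ≥0∞, c ≠ ⊤ ∧ ∀ F : E d → ℝ, IsTest univ F →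
    ‖∫ x in Ω, fderiv ℝ (fun z => χ z * F z) x v‖ₑ ≤ c * eLpNorm F 2 (surface Ω)

lemma isFluxCutoff_zero : IsFluxCutoff Ω v 0 :=
  ⟨contDiff_zero_fun, 0, by simp⟩

lemma IsFluxCutoff.add {a b : E d → ℝ} (ha : IsFluxCutoff Ω v a) (hb : IsFluxCutoff Ω v b) :
    IsFluxCutoff Ω v (a + b) := by
  obtain ⟨ha, c, hc, hca⟩ := ha
  obtain ⟨hb, c', hc', hcb⟩ := hb
  refine ⟨ha.add hb, c + c', by finiteness, fun F hF => ?_⟩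
  have haF := hF.mul_left ha
  have hbF := hF.mul_left hb
  have hadd (x : E d) : fderiv ℝ (fun z => (a + b) z * F z) x v =
      fderiv ℝ (fun z => a z * F z) x v + fderiv ℝ (fun z => b z * F z) x v := by
    simp only [Pi.add_apply, add_mul]
    rw [fderiv_fun_add (haF.differentiable x) (hbF.differentiable x), add_apply]
  simp only [hadd]
  rw [integral_add (memLp_one_iff_integrable.1 (haF.memLp_fderiv_apply v))
    (memLp_one_iff_integrable.1 (hbF.memLp_fderiv_apply v)), add_mul]
  exact (enorm_add_le _ _).trans (add_le_add (hca F hF) (hcb F hF))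

lemma HasFluxBound.isFluxCutoff (hB : HasFluxBound Ω v B) {χ : E d → ℝ} (hχ : IsTest B χ) :
    IsFluxCutoff Ω v χ := by
  obtain ⟨c, hc, hcB⟩ := hB
  obtain ⟨C, hC⟩ := hχ.to_univ.exists_eLpNorm_mul_le (p := 2) (surface Ω)
  refine ⟨hχ.contDiff, c * C, by finiteness, fun F hF =>
    (hcB _ (hχ.mul_right hF.contDiff)).trans ?_⟩
  rw [mul_assoc]
  gcongr
  exact hC F

lemma hasFluxBound_univ_of_forall_exists_nhds (hΩ : IsOpen Ω) (hb : Bornology.IsBounded Ω)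
    (h : ∀ x ∈ closure Ω, ∃ B ∈ 𝓝 x, HasFluxBound Ω v B) : HasFluxBound Ω v univ := by
  obtain ⟨χ, -, hχ, -, c, hc, hcχ⟩ := exists_cutoff hb.isCompact_closure
    (isFluxCutoff_zero (Ω := Ω) (v := v)) (fun _ _ => IsFluxCutoff.add) fun x hx =>
      let ⟨B, hB, hBv⟩ := h x hx
      ⟨B, hB, fun _ h₁ h₂ h₃ => hBv.isFluxCutoff ⟨h₁, h₂, h₃⟩⟩
  refine ⟨c, hc, fun F hF => (hcχ F hF).trans_eq' ?_⟩
  refine congrArg enorm (setIntegral_congr_fun hΩ.measurableSet fun x hx => ?_)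
  have heq : (fun z => χ z * F z) =ᶠ[𝓝 x] F := by
    filter_upwards [hΩ.mem_nhds hx] with z hz
    rw [hχ z (subset_closure hz), one_mul]
  exact DFunLike.congr_fun (heq.fderiv_eq (𝕜 := ℝ)) v

lemma IsC1BoundedOpen.hasFluxBound_univ (hΩ : IsC1BoundedOpen Ω) (v : E d) :
    HasFluxBound Ω v univ :=
  hasFluxBound_univ_of_forall_exists_nhds hΩ.isOpen hΩ.isBounded
    fun _ hx => hΩ.exists_hasFluxBound v hx

end FluxBound

lemma hasZeroExtension_of_tendsto (hΩ : ∀ v, HasFluxBound Ω v univ) {φ : ℕ → E d → ℝ}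
    (hφ : ∀ n, IsTest univ (φ n)) {y : H1 Ω}
    (hy : Tendsto (fun n => (hφ n).toH1 Ω) atTop (𝓝 y))
    (h0 : Tendsto (fun n => eLpNorm (φ n) 2 (surface Ω)) atTop (𝓝 0)) : HasZeroExtension y := by
  intro ψ hψ v
  obtain ⟨c, hc, hflux⟩ := hΩ v
  obtain ⟨C, hC⟩ := hψ.exists_eLpNorm_mul_le (p := 2) (surface Ω)
  have hlim : Tendsto (fun n => weakDefect ψ v (fn ((hφ n).toH1 Ω)) (grad ((hφ n).toH1 Ω))) atTop
      (𝓝 (weakDefect ψ v (fn y) (grad y))) :=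
    (((continuous_weakDefect hψ v).comp continuous_subtype_val).tendsto y).comp hy
  have hle (n) : ‖weakDefect ψ v (fn ((hφ n).toH1 Ω)) (grad ((hφ n).toH1 Ω))‖ₑ ≤
      c * (C * eLpNorm (φ n) 2 (surface Ω)) := by
    rw [(hφ n).weakDefect_toH1 hψ]
    refine (hflux _ (hψ.mul_left (hφ n).contDiff)).trans ?_
    gcongr
    simpa only [mul_comm] using hC (φ n)
  have hzero : Tendsto (fun n => c * (C * eLpNorm (φ n) 2 (surface Ω))) atTop (𝓝 0) := by
    simpa using ENNReal.Tendsto.const_mul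
      (ENNReal.Tendsto.const_mul h0 (Or.inr ENNReal.coe_ne_top)) (Or.inr hc)
  exact enorm_eq_zero.1 (nonpos_iff_eq_zero.1 (le_of_tendsto_of_tendsto' hlim.enorm hzero hle))

lemma HasTrace.sub_mem_H10 (hΩ : IsC1BoundedOpen Ω) {y z : H1 Ω} {g : L2Bdry Ω}
    (hy : HasTrace y g) (hz : HasTrace z g) : y - z ∈ H10 Ω := by
  obtain ⟨φ, hφ, hlim, h0⟩ := hy.exists_tendsto_sub hΩ.isOpen hz
  exact (hasZeroExtension_of_tendsto hΩ.hasFluxBound_univ hφ hlim h0).mem_H10 hΩ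

section WellPosedness

variable {u u₁ u₂ : LInf Ω} {m M : ℝ} {f : HNeg1 Ω} {g : L2Bdry Ω}
  {y y₁ y₂ w : H1 Ω}

lemma abs_apply_le_hNeg1Norm_mul (hd : 1 ≤ d) (hΩ : IsOpen Ω) (hb : Bornology.IsBounded Ω)
    (f : HNeg1 Ω) (φ : H10 Ω) : |f φ| ≤ hNeg1Norm f * h10Norm (φ : H1 Ω) := by
  obtain ⟨C, hC, hpoincare⟩ := exists_norm_le_mul_norm_grad hd hΩ hb
  exact abs_apply_le_sInf_mul_norm (D := gradL) hC.le hpoincare f φ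

lemma exists_mem_H10_forall_inner_add_eq (hd : 1 ≤ d) (hΩ : IsOpen Ω)
    (hb : Bornology.IsBounded Ω) (hm : 0 < m) (hu : ∀ᵐ x ∂(volume.restrict Ω), m ≤ u x)
    (z : H1 Ω) (f : HNeg1 Ω) :
    ∃ w ∈ H10 Ω, ∀ φ : H10 Ω, inner ℝ (mulL u (grad (z + w))) (grad (φ : H1 Ω)) = f φ := by
  obtain ⟨C, hC, hpoincare⟩ := exists_norm_le_mul_norm_grad hd hΩ hb
  exact exists_mem_forall_inner_add_eq_of_coercive (D := gradL) hC hpoincare hm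
    (le_inner_mulL_of_ae_le hu) z f

lemma mul_norm_grad_le_hNeg1Norm (hd : 1 ≤ d) (hΩ : IsOpen Ω) (hb : Bornology.IsBounded Ω)
    (hu : ∀ᵐ x ∂(volume.restrict Ω), m ≤ u x) (hw : w ∈ H10 Ω)
    (hwf : ∀ φ : H10 Ω, inner ℝ (mulL u (grad w)) (grad (φ : H1 Ω)) = f φ) :
    m * ‖grad w‖ ≤ hNeg1Norm f := by
  refine mul_norm_le_of_inner_le (Real.sInf_nonneg fun c hc => hc.1)
    (le_inner_mulL_of_ae_le hu _) ((hwf ⟨w, hw⟩).trans_le ?_)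
  exact (le_abs_self _).trans (abs_apply_le_hNeg1Norm_mul hd hΩ hb f ⟨w, hw⟩)

lemma norm_mulL_le_of_ae_mem_Icc (hm : 0 ≤ m)
    (hu : ∀ᵐ x ∂(volume.restrict Ω), m ≤ u x ∧ u x ≤ M) (X : L2Vec Ω) : ‖mulL u X‖ ≤ M * ‖X‖ :=
  norm_mulL_le_of_ae_norm_le
    (hu.mono fun x hx => by rw [Real.norm_of_nonneg (hm.trans hx.1)]; exact hx.2) X

lemma IsSolution.inner_mulL_eq (hy : IsSolution u f g y) (φ : H10 Ω) :
    inner ℝ (mulL u (grad y)) (grad (φ : H1 Ω)) = f φ :=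
  (inner_mulL ..).trans (hy.1 φ)

lemma exists_isSolution (hd : 1 ≤ d) (hΩ : IsOpen Ω) (hb : Bornology.IsBounded Ω) (hm : 0 < m)
    (hu : ∀ᵐ x ∂(volume.restrict Ω), m ≤ u x) (f : HNeg1 Ω) (hg : MemH12 g) :
    ∃ y, IsSolution u f g y := by
  obtain ⟨z, hz⟩ := hg
  obtain ⟨w, hw, hzw⟩ := exists_mem_H10_forall_inner_add_eq hd hΩ hb hm hu z f
  exact ⟨z + w, fun φ => (inner_mulL ..).symm.trans (hzw φ), hz.add_mem_H10 hΩ hw⟩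

/- The solution with data `(f, g)` is split into the one with data `(f, 0)`, tested against itself,
and the one with data `(0, g)`, tested against its difference with an extension `z` of `g`. -/
lemma IsSolution.mul_norm_grad_le (hd : 1 ≤ d) (hΩ : IsC1BoundedOpen Ω) (hm : 0 < m) (hM : 0 < M)
    (hu : ∀ᵐ x ∂(volume.restrict Ω), m ≤ u x ∧ u x ≤ M) (hy : IsSolution u f g y) :
    m * ‖grad y‖ ≤ hNeg1Norm f + M * h12Norm g := by
  have hum := hu.mono fun _ hx => hx.1
  obtain ⟨w, hw, hwf⟩ : ∃ w ∈ H10 Ω, ∀ φ : H10 Ω,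
      inner ℝ (mulL u (grad w)) (grad (φ : H1 Ω)) = f φ := by
    simpa only [zero_add] using
      exists_mem_H10_forall_inner_add_eq hd hΩ.isOpen hΩ.isBounded hm hum 0 f
  have hwN := mul_norm_grad_le_hNeg1Norm hd hΩ.isOpen hΩ.isBounded hum hw hwf
  have hle (z : H1 Ω) (hz : HasTrace z g) : m * ‖grad y‖ - hNeg1Norm f ≤ M * ‖z‖ := by
    have hyzw : y - z - w ∈ H10 Ω := sub_mem (hy.2.sub_mem_H10 hΩ hz) hw
    have hyw : m * ‖grad y - grad w‖ ≤ M * ‖grad z‖ := by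
      refine mul_norm_le_of_inner_sub_eq_zero hM.le (le_inner_mulL_of_ae_le hum)
        (norm_mulL_le_of_ae_mem_Icc hm.le hu) ?_
      rw [map_sub, inner_sub_left, sub_right_comm, ← grad_sub, ← grad_sub]
      exact sub_eq_zero.2 ((hy.inner_mulL_eq ⟨_, hyzw⟩).trans (hwf ⟨_, hyzw⟩).symm)
    calc m * ‖grad y‖ - hNeg1Norm f ≤ m * (‖grad y‖ - ‖grad w‖) := by linarith
      _ ≤ m * ‖grad y - grad w‖ := by gcongr; exact norm_sub_norm_le _ _
      _ ≤ M * ‖z‖ := hyw.trans (by gcongr; exact norm_grad_le z)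
  rw [← sub_le_iff_le_add', ← div_le_iff₀' hM]
  refine le_csInf ⟨_, y, hy.2, rfl⟩ ?_
  rintro _ ⟨z, hz, rfl⟩
  exact (div_le_iff₀' hM).2 (hle z hz)

lemma IsSolution.mul_norm_grad_sub_le (hΩ : IsC1BoundedOpen Ω)
    (hu₁ : ∀ᵐ x ∂(volume.restrict Ω), m ≤ u₁ x) (h₁ : IsSolution u₁ f g y₁)
    (h₂ : IsSolution u₂ f g y₂) : m * ‖grad (y₁ - y₂)‖ ≤ ‖u₁ - u₂‖ * ‖grad y₂‖ := by
  have hmem := h₁.2.sub_mem_H10 hΩ h₂.2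
  refine mul_norm_sub_le_of_inner_sub_eq (norm_nonneg _) (le_inner_mulL_of_ae_le hu₁)
    (fun X => ?_) ((h₁.inner_mulL_eq ⟨_, hmem⟩).trans (h₂.inner_mulL_eq ⟨_, hmem⟩).symm)
  rw [← sub_apply, ← mulL_sub]
  exact norm_mulL_le _ X

lemma IsSolution.h10Norm_sub_le (hd : 1 ≤ d) (hΩ : IsC1BoundedOpen Ω) (hm : 0 < m) (hM : 0 < M)
    (hu₁ : ∀ᵐ x ∂(volume.restrict Ω), m ≤ u₁ x)
    (hu₂ : ∀ᵐ x ∂(volume.restrict Ω), m ≤ u₂ x ∧ u₂ x ≤ M) (h₁ : IsSolution u₁ f g y₁)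
    (h₂ : IsSolution u₂ f g y₂) :
    h10Norm (y₁ - y₂) ≤ 1 / m ^ 2 * ‖u₁ - u₂‖ * (hNeg1Norm f + M * h12Norm g) := by
  have hy₂ : ‖grad y₂‖ ≤ (hNeg1Norm f + M * h12Norm g) / m :=
    (le_div_iff₀' hm).2 (h₂.mul_norm_grad_le hd hΩ hm hM hu₂)
  calc h10Norm (y₁ - y₂) ≤ ‖u₁ - u₂‖ * ‖grad y₂‖ / m :=
        (le_div_iff₀' hm).2 (h₁.mul_norm_grad_sub_le hΩ hu₁ h₂)
    _ ≤ ‖u₁ - u₂‖ * ((hNeg1Norm f + M * h12Norm g) / m) / m := by gcongr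
    _ = 1 / m ^ 2 * ‖u₁ - u₂‖ * (hNeg1Norm f + M * h12Norm g) := by field_simp

lemma IsSolution.eq (hd : 1 ≤ d) (hΩ : IsC1BoundedOpen Ω) (hm : 0 < m)
    (hu : ∀ᵐ x ∂(volume.restrict Ω), m ≤ u x) (h₁ : IsSolution u f g y₁)
    (h₂ : IsSolution u f g y₂) : y₁ = y₂ := by
  obtain ⟨C, -, hpoincare⟩ := exists_norm_le_mul_norm_grad hd hΩ.isOpen hΩ.isBounded
  have hgrad : ‖grad (y₁ - y₂)‖ = 0 := by
    have hle := h₁.mul_norm_grad_sub_le hΩ hu h₂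
    rw [sub_self, norm_zero, zero_mul] at hle
    exact (nonpos_of_mul_nonpos_right hle hm).antisymm (norm_nonneg _)
  have hle := hpoincare _ (h₁.2.sub_mem_H10 hΩ h₂.2)
  rw [hgrad, mul_zero, norm_le_zero_iff] at hle
  exact sub_eq_zero.1 hle

lemma exists_lipschitzWith_of_h10Norm_sub_le (hd : 1 ≤ d) (hΩ : IsOpen Ω)
    (hb : Bornology.IsBounded Ω) {X : Type*} [PseudoMetricSpace X] {S : X → H1 Ω} {c : ℝ}
    (hS : ∀ a b, S a - S b ∈ H10 Ω ∧ h10Norm (S a - S b) ≤ c * dist a b) :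
    ∃ K, LipschitzWith K S := by
  obtain ⟨C, hC, hpoincare⟩ := exists_norm_le_mul_norm_grad hd hΩ hb
  refine ⟨_, LipschitzWith.of_dist_le' (K := C * c) fun a b => ?_⟩
  rw [dist_eq_norm, mul_assoc]
  exact (hpoincare _ (hS a b).1).trans (mul_le_mul_of_nonneg_left (hS a b).2 hC.le)

end WellPosedness

end

end Conductivity

theorem mainTheorem8_general {d : ℕ} (hd : 1 ≤ d) {Ω : Set (Conductivity.E d)}
    (hΩ : Conductivity.IsC1BoundedOpen Ω)
    (F : Submodule ℝ (Conductivity.LInf Ω)) {m M : ℝ} (hm : 0 < m) (hmM : m ≤ M)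
    (f : Conductivity.HNeg1 Ω) (g : Conductivity.L2Bdry Ω) (hg : Conductivity.MemH12 g) :
    ∃ S : Conductivity.U F m M → Conductivity.H1 Ω,
      (∀ (u : Conductivity.U F m M) (y : Conductivity.H1 Ω),
        Conductivity.IsSolution (u : Conductivity.LInf Ω) f g y ↔ y = S u) ∧
      (∀ u₁ u₂ : Conductivity.U F m M,
        S u₁ - S u₂ ∈ Conductivity.H10 Ω ∧
        Conductivity.h10Norm (S u₁ - S u₂) ≤
          1 / m ^ 2 * ‖(u₁ : Conductivity.LInf Ω) - (u₂ : Conductivity.LInf Ω)‖ *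
            (Conductivity.hNeg1Norm f + M * Conductivity.h12Norm g)) ∧
      ∃ K : ℝ≥0, LipschitzWith K S := by
  have hum (u : Conductivity.U F m M) :=
    u.2.2.mono fun x (hx : m ≤ (u : Conductivity.LInf Ω) x ∧ _) => hx.1
  choose S hS using fun u : Conductivity.U F m M =>
    Conductivity.exists_isSolution hd hΩ.isOpen hΩ.isBounded hm (hum u) f hg
  have hbound (u₁ u₂) := (hS u₁).h10Norm_sub_le hd hΩ hm (hm.trans_le hmM) (hum u₁) u₂.2.2 (hS u₂)
  have hmem (u₁ u₂) := (hS u₁).2.sub_mem_H10 hΩ (hS u₂).2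
  refine ⟨S, fun u y => ⟨fun hy => hy.eq hd hΩ hm (hum u) (hS u), fun hy => hy ▸ hS u⟩,
    fun u₁ u₂ => ⟨hmem u₁ u₂, hbound u₁ u₂⟩, ?_⟩
  exact Conductivity.exists_lipschitzWith_of_h10Norm_sub_le hd hΩ.isOpen hΩ.isBounded
    fun u₁ u₂ => ⟨hmem u₁ u₂, (hbound u₁ u₂).trans_eq
      ((mul_right_comm _ _ _).trans (congrArg _ (dist_eq_norm _ _).symm))⟩

theorem mainTheorem8 {d : ℕ} (hd : 1 ≤ d) {Ω : Set (Conductivity.E d)}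
    (hΩ : Conductivity.IsSmoothBoundedOpen Ω)
    (F : Submodule ℝ (Conductivity.LInf Ω)) {m M : ℝ} (hm : 0 < m) (hmM : m < M)
    (f : Conductivity.HNeg1 Ω) (g : Conductivity.L2Bdry Ω) (hg : Conductivity.MemH12 g) :
    ∃ S : Conductivity.U F m M → Conductivity.H1 Ω,
      (∀ (u : Conductivity.U F m M) (y : Conductivity.H1 Ω),
        Conductivity.IsSolution (u : Conductivity.LInf Ω) f g y ↔ y = S u) ∧
      (∀ u₁ u₂ : Conductivity.U F m M,
        S u₁ - S u₂ ∈ Conductivity.H10 Ω ∧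
        Conductivity.h10Norm (S u₁ - S u₂) ≤
          1 / m ^ 2 * ‖(u₁ : Conductivity.LInf Ω) - (u₂ : Conductivity.LInf Ω)‖ *
            (Conductivity.hNeg1Norm f + M * Conductivity.h12Norm g)) ∧
      ∃ K : ℝ≥0, LipschitzWith K S :=
  mainTheorem8_general hd hΩ.isC1BoundedOpen F hm hmM.le f g hg
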